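/- **Languages.** Let $\Phi$ (primitive propositions) and $\mathcal X$ (variables) be countably infinite sets and let $1,\dots,n$ be agents. $\mathcal L^{\forall,K,X,A}_n(\Phi,\mathcal X)$ is the set of formulas built from $\Phi\cup\mathcal X$ with $\neg$, $\wedge$, $K_i$, $A_i$, $X_i$ ($1\le i\le n$) and $\forall x$ ($x\in\mathcal X$); $\vee$, $\Rightarrow$, $\Leftrightarrow$ are the usual abbreviations. $\mathcal L^{\forall,K}_n(\Phi,\mathcal X)$ consists of the formulas without $A_i$, $X_i$; $\mathcal L^{K,X,A}_n(\Phi)$ and $\mathcal L^{K}_n(\Phi)$ consist of the formulas of these two languages, respectively, that contain no quantifiers and no variables. A sentence is a formula without free variables, and $\Phi(\varphi)$ is the set of primitive propositions occurring in $\varphi$. Write $A_i^*\varphi$ for $K_i(\varphi\vee\neg\varphi)$. An empty conjunction is *true*, e.g. $\forall x(x\vee\neg x)$. **Structures.** An extended awareness structure $M=(S,L,\pi,\mathcal K_1,\dots,\mathcal K_n,\mathcal A_1,\dots,\mathcal A_n)$ consists of a set $S$ of worlds, a map $L$ from $S$ to nonempty subsets of $\Phi$, an interpretation $\pi:S\times\Phi\to\{\mathbf{true},\mathbf{false}\}$,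 binary relations $\mathcal K_i$ on $S$, and sets $\mathcal A_i(s)$ of sentences of $\mathcal L^{\forall,K,X,A}_n(L(s),\mathcal X)$. $\mathcal N_n^{r,t,e}$ is the class of those structures in which every $\mathcal K_i$ is reflexive, transitive and Euclidean, a sentence $\varphi$ is in $\mathcal A_i(s)$ iff $\Phi(\varphi)\subseteq\mathcal A_i(s)$, and $(s,t)\in\mathcal K_i$ implies $\mathcal A_i(s)=\mathcal A_i(t)$. A sentence $\varphi$ can be true at $s$ only if $\Phi(\varphi)\subseteq L(s)$. Under this proviso: $p\in\Phi$ is true at $s$ iff $\pi(s,p)=\mathbf{true}$; $\neg\varphi$ iff $\varphi$ is not true at $s$; $\varphi\wedge\psi$ iff both are; $K_i\varphi$ iff $\varphi$ is true at all $t$ with $(s,t)\in\mathcal K_i$; $A_i\varphi$ iff $\varphi\in\mathcal A_i(s)$; $X_i\varphi$ iff $A_i\varphi$ and $K_i\varphi$ are true at $s$; $\forall x\varphi$ iff $\varphi[x/\psi]$ is true at $s$ for all $\psi\in\mathcal L^{K,X,A}_n(L(s))$. For the languages without $A_i$, $X_i$ the quantifier ranges over $\psi\in\mathcal L^{K}_n(L(s))$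 instead. $\varphi$ is valid in $\mathcal N_n^{r,t,e}$ if it is true at every world $s$ of every structure in the class with $\Phi(\varphi)\subseteq L(s)$. **Axioms and rules** (all instances are sentences of the language at hand). * Prop: all substitution instances of propositional tautologies. * K: $(K_i\varphi\wedge K_i(\varphi\Rightarrow\psi))\Rightarrow K_i\psi$. T: $K_i\varphi\Rightarrow\varphi$. 4: $K_i\varphi\Rightarrow K_iK_i\varphi$. * AGPP$^*$: $A_i^*\varphi\Leftrightarrow\bigwedge_{p\in\Phi(\varphi)}A_i^*p$. A0$^*$: $K_i\varphi\Rightarrow A_i^*\varphi$. 5$^*$: $(\neg K_i\varphi\wedge A_i^*\varphi)\Rightarrow K_i\neg K_i\varphi$. * $1_\forall$: $\forall x\varphi\Rightarrow\varphi[x/\psi]$ for $\psi$ a quantifier-free sentence. K$_\forall$: $\forall x(\varphi\Rightarrow\psi)\Rightarrow(\forall x\varphi\Rightarrow\forall x\psi)$. N$_\forall$: $\varphi\Rightarrow\forall x\varphi$ if $x$ is not free in $\varphi$. * Barcan$^*$: $(A_i^*(\forall x\varphi)\wedge\forall x(A_i^*x\Rightarrow K_i\varphi))\Rightarrow K_i(\forall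 xA_i^*x\Rightarrow\forall x\varphi)$. FA$^*$: $\forall x\neg A_i^*x\Rightarrow K_i\forall x\neg A_i^*x$. * AGPP: $A_i\varphi\Leftrightarrow\bigwedge_{p\in\Phi(\varphi)}A_ip$. KA: $A_i\varphi\Rightarrow K_iA_i\varphi$. A0: $X_i\varphi\Leftrightarrow K_i\varphi\wedge A_i\varphi$. * MP: from $\varphi$ and $\varphi\Rightarrow\psi$ infer $\psi$. Gen$^*$: from $\varphi$ infer $A_i^*\varphi\Rightarrow K_i\varphi$. Gen$_\forall$: for $q\in\Phi$, from $\varphi$ infer $\forall x\,\varphi[q/x]$, provided no occurrence of $q$ in $\varphi$ is in the scope of a quantifier $\forall x$. **Theorem.** With respect to $\mathcal N_n^{r,t,e}$, the following axiom systems are sound and complete (a sentence of the language is provable iff it is valid): (a) $\mathrm{AX}^{K,X,A,A^*,\forall}_e\cup\{\mathrm T,4,5^*\}=\{$Prop, AGPP, KA, A0, K, AGPP$^*$, A0$^*$, $1_\forall$, K$_\forall$, N$_\forall$, Barcan$^*$, FA$^*$, MP, Gen$^*$, Gen$_\forall$, T, 4, 5$^*\}$, for the sentences of $\mathcal L^{\forall,K,X,A}_n(\Phi,\mathcal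 X)$; (b) $\mathrm{AX}^{K,A^*,\forall}_e\cup\{\mathrm T,4,5^*\}=\{$Prop, K, AGPP$^*$, A0$^*$, $1_\forall$, K$_\forall$, N$_\forall$, Barcan$^*$, FA$^*$, MP, Gen$^*$, Gen$_\forall$, T, 4, 5$^*\}$, for the sentences of $\mathcal L^{\forall,K}_n(\Phi,\mathcal X)$; (c) $\mathrm{AX}^{K,A^*}_e\cup\{\mathrm T,4,5^*\}=\{$Prop, AGPP$^*$, K, A0$^*$, MP, Gen$^*$, T, 4, 5$^*\}$, for $\mathcal L^{K}_n(\Phi)$. -/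

import Mathlib

universe u

namespace Awareness

/-- Formulas over the agents `Fin n`, the primitive propositions `Φ` and the variables `V`.
`K i`, `A i`, `X i` are implicit knowledge, awareness and explicit knowledge of agent `i`. -/
inductive Formula (n : ℕ) (Φ V : Type u) : Type u
  | prim (p : Φ) : Formula n Φ V
  | var (x : V) : Formula n Φ V
  | neg (φ : Formula n Φ V) : Formula n Φ V
  | and (φ ψ : Formula n Φ V) : Formula n Φ V
  | K (i : Fin n) (φ : Formula n Φ V) : Formula n Φ V
  | A (i : Fin n) (φ : Formula n Φ V) : Formula n Φ V
  | X (i : Fin n) (φ : Formula n Φ V) : Formula n Φ V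
  | all (x : V) (φ : Formula n Φ V) : Formula n Φ V

namespace Formula

variable {n : ℕ} {Φ V : Type u}

/-! ### Abbreviations -/

/-- `φ ∨ ψ`, that is, `¬(¬φ ∧ ¬ψ)`. -/
def or (φ ψ : Formula n Φ V) : Formula n Φ V := neg (and (neg φ) (neg ψ))

/-- `φ ⇒ ψ`, that is, `¬φ ∨ ψ`. -/
def imp (φ ψ : Formula n Φ V) : Formula n Φ V := or (neg φ) ψ

/-- `φ ⇔ ψ`. -/
def iff (φ ψ : Formula n Φ V) : Formula n Φ V := and (imp φ ψ) (imp ψ φ)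

/-- `A_i^* φ`, that is, `K_i (φ ∨ ¬φ)`. -/
def Astar (i : Fin n) (φ : Formula n Φ V) : Formula n Φ V := K i (or φ (neg φ))

/-- The formula `∀ x (x ∨ ¬x)`, which mentions no primitive proposition; it serves as `true`. -/
def verum (x : V) : Formula n Φ V := all x (or (var x) (neg (var x)))

/-- The conjunction of a list of formulas; the empty conjunction is `true`, written with the
bound variable `x`. -/
def conj (x : V) : List (Formula n Φ V) → Formula n Φ V
  | [] => verum x
  | [φ] => φ
  | φ :: ψ :: l => and φ (conj x (ψ :: l))

/-! ### Syntactic notions -/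

/-- The set `Φ(φ)` of primitive propositions that occur in `φ`. -/
def prims : Formula n Φ V → Set Φ
  | prim p => {p}
  | var _ => ∅
  | neg φ => prims φ
  | and φ ψ => prims φ ∪ prims ψ
  | K _ φ => prims φ
  | A _ φ => prims φ
  | X _ φ => prims φ
  | all _ φ => prims φ

/-- The variables that are free in a formula. -/
def free : Formula n Φ V → Set V
  | prim _ => ∅
  | var x => {x}
  | neg φ => free φ
  | and φ ψ => free φ ∪ free ψ
  | K _ φ => free φ
  | A _ φ => free φ
  | X _ φ => free φ
  | all x φ => free φ \ {x}

/-- A sentence is a formula without free variables. -/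
def IsSentence (φ : Formula n Φ V) : Prop := φ.free = ∅

/-- The formula mentions neither quantification nor variables. -/
def QuantFree : Formula n Φ V → Prop
  | prim _ => True
  | var _ => False
  | neg φ => QuantFree φ
  | and φ ψ => QuantFree φ ∧ QuantFree ψ
  | K _ φ => QuantFree φ
  | A _ φ => QuantFree φ
  | X _ φ => QuantFree φ
  | all _ _ => False

/-- The formula mentions none of the operators `A i`, `X i`. -/
def KOnly : Formula n Φ V → Prop
  | prim _ => True
  | var _ => True
  | neg φ => KOnly φ
  | and φ ψ => KOnly φ ∧ KOnly ψ
  | K _ φ => KOnly φ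
  | A _ _ => False
  | X _ _ => False
  | all _ φ => KOnly φ

open Classical in
/-- `φ[x/ψ]`, written `φ.substVar x ψ`: replace all free occurrences of the variable `x` in `φ` by
`ψ`. Only used where `ψ` is a sentence, so that no variable can be captured. -/
noncomputable def substVar (φ : Formula n Φ V) (x : V) (ψ : Formula n Φ V) : Formula n Φ V :=
  match φ with
  | prim p => prim p
  | var y => if y = x then ψ else var y
  | neg φ => neg (φ.substVar x ψ)
  | and φ χ => and (φ.substVar x ψ) (χ.substVar x ψ)
  | K i φ => K i (φ.substVar x ψ)
  | A i φ => A i (φ.substVar x ψ)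
  | X i φ => X i (φ.substVar x ψ)
  | all y φ => if y = x then all y φ else all y (φ.substVar x ψ)

open Classical in
/-- `φ[q/ψ]`, written `φ.substPrim q ψ`: replace all occurrences of the primitive proposition `q`
in `φ` by `ψ`. -/
noncomputable def substPrim (φ : Formula n Φ V) (q : Φ) (ψ : Formula n Φ V) : Formula n Φ V :=
  match φ with
  | prim p => if p = q then ψ else prim p
  | var y => var y
  | neg φ => neg (φ.substPrim q ψ)
  | and φ χ => and (φ.substPrim q ψ) (χ.substPrim q ψ)
  | K i φ => K i (φ.substPrim q ψ)
  | A i φ => A i (φ.substPrim q ψ)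
  | X i φ => X i (φ.substPrim q ψ)
  | all y φ => all y (φ.substPrim q ψ)

/-- The variable `x` is substitutable for the primitive proposition `q` in a formula:
no occurrence of `q` lies in the scope of a quantifier `∀ x`. -/
def Substitutable (x : V) (q : Φ) : Formula n Φ V → Prop
  | prim _ => True
  | var _ => True
  | neg φ => Substitutable x q φ
  | and φ ψ => Substitutable x q φ ∧ Substitutable x q ψ
  | K _ φ => Substitutable x q φ
  | A _ φ => Substitutable x q φ
  | X _ φ => Substitutable x q φ
  | all y φ => (y = x → q ∉ φ.prims) ∧ Substitutable x q φ

/-- The number of quantifiers in a formula. -/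
def numAll : Formula n Φ V → ℕ
  | prim _ => 0
  | var _ => 0
  | neg φ => numAll φ
  | and φ ψ => numAll φ + numAll ψ
  | K _ φ => numAll φ
  | A _ φ => numAll φ
  | X _ φ => numAll φ
  | all _ φ => numAll φ + 1

theorem numAll_eq_zero {ψ : Formula n Φ V} (h : ψ.QuantFree) : ψ.numAll = 0 := by
  induction ψ with
  | prim | var => rfl
  | neg φ ih | K _ φ ih | A _ φ ih | X _ φ ih => exact ih h
  | and φ χ ih₁ ih₂ => simp [numAll, ih₁ h.1, ih₂ h.2]
  | all _ _ => exact h.elim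

theorem numAll_substVar (x : V) {ψ : Formula n Φ V} (h : ψ.QuantFree) (φ : Formula n Φ V) :
    (φ.substVar x ψ).numAll = φ.numAll := by
  induction φ with
  | prim => rfl
  | var y =>
    by_cases hy : y = x
    · simp [substVar, hy, numAll, numAll_eq_zero h]
    · simp [substVar, hy]
  | neg φ ih | K _ φ ih | A _ φ ih | X _ φ ih => simpa [substVar, numAll] using ih
  | and φ χ ih₁ ih₂ => simp [substVar, numAll, ih₁, ih₂]
  | all y φ ih => by_cases hy : y = x <;> simp [substVar, hy, numAll, ih]

end Formula

/-! ### Languages (sets of sentences) -/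

section Languages

variable (n : ℕ) (Φ V : Type u)

/-- The sentences of `L^{∀,K,X,A}_n(Φ,V)`. -/
def LAllKXA : Set (Formula n Φ V) := {φ | φ.IsSentence}

/-- The sentences of `L^{∀,K}_n(Φ,V)`. -/
def LAllK : Set (Formula n Φ V) := {φ | φ.IsSentence ∧ φ.KOnly}

/-- The language `L^{K,X,A}_n(Φ)`. -/
def LKXA : Set (Formula n Φ V) := {φ | φ.QuantFree}

/-- The language `L^K_n(Φ)`. -/
def LK : Set (Formula n Φ V) := {φ | φ.QuantFree ∧ φ.KOnly}

end Languages

/-! ### Extended awareness structures -/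

/-- An extended awareness structure for `n` agents over `Φ`. -/
structure ExtStructure (n : ℕ) (Φ V : Type u) where
  /-- The worlds. -/
  World : Type u
  /-- The primitive propositions of the language associated with each world. -/
  lang : World → Set Φ
  lang_nonempty : ∀ s, (lang s).Nonempty
  /-- The interpretation of the primitive propositions. -/
  val : World → Φ → Bool
  /-- The possibility relations. -/
  rel : Fin n → World → World → Prop
  /-- The sentences that each agent is aware of at each world. -/
  aware : Fin n → World → Set (Formula n Φ V)
  aware_sentence : ∀ i s, ∀ φ ∈ aware i s, φ.IsSentence
  aware_lang : ∀ i s, ∀ φ ∈ aware i s, φ.prims ⊆ lang s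

namespace ExtStructure

variable {n : ℕ} {Φ V : Type u}

/-- Truth at a world of the sentence `φ`, where the quantifiers range over those sentences of the
quantifier-free language `R` that belong to the language of the world. A sentence is true at a
world only if it belongs to the language of the world. (Variables that are free get the value
false; this is never used for sentences.) -/
def Sat (M : ExtStructure n Φ V) (R : Set (Formula n Φ V)) (s : M.World) :
    Formula n Φ V → Prop
  | .prim p => p ∈ M.lang s ∧ M.val s p = true
  | .var _ => False
  | .neg φ => φ.prims ⊆ M.lang s ∧ ¬ M.Sat R s φ
  | .and φ ψ => M.Sat R s φ ∧ M.Sat R s ψ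
  | .K i φ => φ.prims ⊆ M.lang s ∧ ∀ t, M.rel i s t → M.Sat R t φ
  | .A i φ => φ.prims ⊆ M.lang s ∧ φ ∈ M.aware i s
  | .X i φ => (φ.prims ⊆ M.lang s ∧ φ ∈ M.aware i s) ∧
      (φ.prims ⊆ M.lang s ∧ ∀ t, M.rel i s t → M.Sat R t φ)
  | .all x φ => φ.prims ⊆ M.lang s ∧
      ∀ ψ : Formula n Φ V, ψ.QuantFree → ψ ∈ R → ψ.prims ⊆ M.lang s →
        M.Sat R s (φ.substVar x ψ)
termination_by φ => (φ.numAll, sizeOf φ)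
decreasing_by
  all_goals simp only [Formula.numAll, Prod.lex_def]
  all_goals try rw [Formula.numAll_substVar _ ‹_›]
  all_goals simp
  all_goals omega

/-- Awareness is generated by primitive propositions. -/
def Agpp (M : ExtStructure n Φ V) : Prop :=
  ∀ i s (φ : Formula n Φ V), φ.IsSentence →
    (φ ∈ M.aware i s ↔ ∀ p ∈ φ.prims, Formula.prim p ∈ M.aware i s)

/-- Agents know what they are aware of. -/
def Ka (M : ExtStructure n Φ V) : Prop :=
  ∀ i s t, M.rel i s t → M.aware i s = M.aware i t

/-- Membership in the class `N_n^{r,t,e}`: awareness satisfies `agpp` and `ka`, and every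
possibility relation is reflexive, transitive and Euclidean. -/
structure IsNrte (M : ExtStructure n Φ V) : Prop where
  agpp : M.Agpp
  ka : M.Ka
  refl : ∀ i s, M.rel i s s
  trans : ∀ i s t u, M.rel i s t → M.rel i t u → M.rel i s u
  eucl : ∀ i s t u, M.rel i s t → M.rel i s u → M.rel i t u

end ExtStructure

/-- Validity in `N_n^{r,t,e}`: truth at all worlds whose language contains the sentence. The
quantifiers range over the quantifier-free language `R`. -/
def Valid {n : ℕ} {Φ V : Type u} (R : Set (Formula n Φ V)) (φ : Formula n Φ V) : Prop :=
  ∀ M : ExtStructure n Φ V, M.IsNrte → ∀ s : M.World, φ.prims ⊆ M.lang s → M.Sat R s φ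

/-! ### Axioms -/

/-- Formulas of propositional logic. -/
inductive PropForm : Type
  | atom (k : ℕ) : PropForm
  | neg (θ : PropForm) : PropForm
  | and (θ η : PropForm) : PropForm

namespace PropForm

/-- The truth value under an assignment to the atoms. -/
def eval (v : ℕ → Bool) : PropForm → Bool
  | atom k => v k
  | neg θ => !(eval v θ)
  | and θ η => eval v θ && eval v η

/-- The substitution instance given by `σ`. -/
def inst {n : ℕ} {Φ V : Type u} (σ : ℕ → Formula n Φ V) : PropForm → Formula n Φ V
  | atom k => σ k
  | neg θ => .neg (inst σ θ)
  | and θ η => .and (inst σ θ) (inst σ η)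

end PropForm

section Axioms

open Formula

variable (n : ℕ) (Φ V : Type u)

/-- Prop: substitution instances of valid formulas of propositional logic. -/
def axProp : Set (Formula n Φ V) :=
  {φ | ∃ (θ : PropForm) (σ : ℕ → Formula n Φ V), (∀ v, θ.eval v = true) ∧ φ = θ.inst σ}

/-- AGPP: `A_i φ ⇔ ⋀_{p ∈ Φ(φ)} A_i p`, for every enumeration of `Φ(φ)`. -/
def axAGPP : Set (Formula n Φ V) :=
  {χ | ∃ (i : Fin n) (φ : Formula n Φ V) (l : List Φ) (x : V),
    l.Nodup ∧ (∀ p, p ∈ l ↔ p ∈ φ.prims) ∧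
      χ = iff (A i φ) (conj x (l.map fun p => A i (prim p)))}

/-- KA: `A_i φ ⇒ K_i A_i φ`. -/
def axKA : Set (Formula n Φ V) :=
  {χ | ∃ (i : Fin n) (φ : Formula n Φ V), χ = imp (A i φ) (K i (A i φ))}

/-- A0: `X_i φ ⇔ K_i φ ∧ A_i φ`. -/
def axA0 : Set (Formula n Φ V) :=
  {χ | ∃ (i : Fin n) (φ : Formula n Φ V), χ = iff (X i φ) (and (K i φ) (A i φ))}

/-- K: `(K_i φ ∧ K_i (φ ⇒ ψ)) ⇒ K_i ψ`. -/
def axK : Set (Formula n Φ V) :=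
  {χ | ∃ (i : Fin n) (φ ψ : Formula n Φ V),
    χ = imp (and (K i φ) (K i (imp φ ψ))) (K i ψ)}

/-- T: `K_i φ ⇒ φ`. -/
def axT : Set (Formula n Φ V) :=
  {χ | ∃ (i : Fin n) (φ : Formula n Φ V), χ = imp (K i φ) φ}

/-- 4: `K_i φ ⇒ K_i K_i φ`. -/
def ax4 : Set (Formula n Φ V) :=
  {χ | ∃ (i : Fin n) (φ : Formula n Φ V), χ = imp (K i φ) (K i (K i φ))}

/-- 5^*: `(¬K_i φ ∧ A_i^* φ) ⇒ K_i ¬K_i φ`. -/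
def ax5Star : Set (Formula n Φ V) :=
  {χ | ∃ (i : Fin n) (φ : Formula n Φ V),
    χ = imp (and (neg (K i φ)) (Astar i φ)) (K i (neg (K i φ)))}

/-- AGPP^*: `A_i^* φ ⇔ ⋀_{p ∈ Φ(φ)} A_i^* p`, for every enumeration of `Φ(φ)`. -/
def axAGPPStar : Set (Formula n Φ V) :=
  {χ | ∃ (i : Fin n) (φ : Formula n Φ V) (l : List Φ) (x : V),
    l.Nodup ∧ (∀ p, p ∈ l ↔ p ∈ φ.prims) ∧
      χ = iff (Astar i φ) (conj x (l.map fun p => Astar i (prim p)))}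

/-- A0^*: `K_i φ ⇒ A_i^* φ`. -/
def axA0Star : Set (Formula n Φ V) :=
  {χ | ∃ (i : Fin n) (φ : Formula n Φ V), χ = imp (K i φ) (Astar i φ)}

/-- 1_∀: `∀x φ ⇒ φ[x/ψ]` for a quantifier-free sentence `ψ`. -/
def ax1All : Set (Formula n Φ V) :=
  {χ | ∃ (x : V) (φ ψ : Formula n Φ V), ψ.QuantFree ∧ χ = imp (all x φ) (φ.substVar x ψ)}

/-- K_∀: `∀x (φ ⇒ ψ) ⇒ (∀x φ ⇒ ∀x ψ)`. -/
def axKAll : Set (Formula n Φ V) :=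
  {χ | ∃ (x : V) (φ ψ : Formula n Φ V),
    χ = imp (all x (imp φ ψ)) (imp (all x φ) (all x ψ))}

/-- N_∀: `φ ⇒ ∀x φ` if `x` is not free in `φ`. -/
def axNAll : Set (Formula n Φ V) :=
  {χ | ∃ (x : V) (φ : Formula n Φ V), x ∉ φ.free ∧ χ = imp φ (all x φ)}

/-- Barcan^*: `(A_i^* (∀x φ) ∧ ∀x (A_i^* x ⇒ K_i φ)) ⇒ K_i (∀x A_i^* x ⇒ ∀x φ)`. -/
def axBarcanStar : Set (Formula n Φ V) :=
  {χ | ∃ (i : Fin n) (x : V) (φ : Formula n Φ V),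
    χ = imp (and (Astar i (all x φ)) (all x (imp (Astar i (var x)) (K i φ))))
      (K i (imp (all x (Astar i (var x))) (all x φ)))}

/-- FA^*: `∀x ¬A_i^* x ⇒ K_i ∀x ¬A_i^* x`. -/
def axFAStar : Set (Formula n Φ V) :=
  {χ | ∃ (i : Fin n) (x : V),
    χ = imp (all x (neg (Astar i (var x)))) (K i (all x (neg (Astar i (var x)))))}

end Axioms

/-! ### Axiom systems -/

open Formula in
/-- Provability from the axioms in `Ax` by MP and Gen^* and, in a system with quantification
(`quant`), Gen_∀. -/
inductive Provable {n : ℕ} {Φ V : Type u} (Ax : Set (Formula n Φ V)) (quant : Prop) :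
    Formula n Φ V → Prop
  /-- An axiom is provable. -/
  | ax {φ : Formula n Φ V} : φ ∈ Ax → Provable Ax quant φ
  /-- MP: from `φ` and `φ ⇒ ψ` infer `ψ`. -/
  | mp {φ ψ : Formula n Φ V} :
      Provable Ax quant φ → Provable Ax quant (imp φ ψ) → Provable Ax quant ψ
  /-- Gen^*: from `φ` infer `A_i^* φ ⇒ K_i φ`. -/
  | genStar (i : Fin n) {φ : Formula n Φ V} :
      Provable Ax quant φ → Provable Ax quant (imp (Astar i φ) (K i φ))
  /-- Gen_∀: from `φ` infer `∀x φ[q/x]`. -/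
  | genAll (hquant : quant) (x : V) (q : Φ) {φ : Formula n Φ V} (hx : φ.Substitutable x q) :
      Provable Ax quant φ → Provable Ax quant (all x (φ.substPrim q (var x)))

section Systems

variable (n : ℕ) (Φ V : Type u)

/-- The axiom schemes of `AX^{K,A^*}_e ∪ {T, 4, 5^*}`. -/
def schemesK : Set (Formula n Φ V) :=
  axProp n Φ V ∪ axAGPPStar n Φ V ∪ axK n Φ V ∪ axA0Star n Φ V ∪
    axT n Φ V ∪ ax4 n Φ V ∪ ax5Star n Φ V

/-- The axiom schemes of `AX^{K,A^*,∀}_e ∪ {T, 4, 5^*}`. -/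
def schemesAllK : Set (Formula n Φ V) :=
  schemesK n Φ V ∪ ax1All n Φ V ∪ axKAll n Φ V ∪ axNAll n Φ V ∪
    axBarcanStar n Φ V ∪ axFAStar n Φ V

/-- The axiom schemes of `AX^{K,X,A,A^*,∀}_e ∪ {T, 4, 5^*}`. -/
def schemesAllKXA : Set (Formula n Φ V) :=
  schemesAllK n Φ V ∪ axAGPP n Φ V ∪ axKA n Φ V ∪ axA0 n Φ V

end Systems

variable {n : ℕ} {Φ V : Type u}

/-- Provability in `AX^{K,X,A,A^*,∀}_e ∪ {T, 4, 5^*}`; the axioms are the instances of the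
schemes that are sentences of `L^{∀,K,X,A}_n(Φ,V)`. -/
def ProvableAllKXA (φ : Formula n Φ V) : Prop :=
  Provable (schemesAllKXA n Φ V ∩ LAllKXA n Φ V) True φ

/-- Provability in `AX^{K,A^*,∀}_e ∪ {T, 4, 5^*}`; the axioms are the instances of the
schemes that are sentences of `L^{∀,K}_n(Φ,V)`. -/
def ProvableAllK (φ : Formula n Φ V) : Prop :=
  Provable (schemesAllK n Φ V ∩ LAllK n Φ V) True φ

/-- Provability in `AX^{K,A^*}_e ∪ {T, 4, 5^*}`; the axioms are the instances of the
schemes that belong to `L^K_n(Φ)`. -/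
def ProvableK (φ : Formula n Φ V) : Prop :=
  Provable (schemesK n Φ V ∩ LK n Φ V) False φ

end Awareness

/-! Two flags treat the three systems at once: `k` removes the operators `A i` and `X i`, and `q`
admits quantifiers.

Soundness is delicate only for MP and Gen_∀. Validity looks only at worlds whose language contains
the sentence, so in MP the premise `φ` may mention propositions that are undefined where `ψ` has to
hold. Both rules are handled by `pullback`: given a substitution `σ` of quantifier-free sentences
for primitive propositions, let `p` mean in a new structure what `σ p` means in the old one. A
sentence holds in the new structure iff its substitution instance holds in the old one
(`sat_pullback`). For MP, `σ` moves the superfluous propositions of `φ` to a defined one; for Gen_∀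
it sends `q` to the instantiating sentence.

Completeness uses a canonical structure. A world is a set `L` of propositions with infinite
complement and a maximal consistent set `Γ` over `L` that has a quantifier-free counterexample to
each universal sentence it refutes; worlds are `i`-related if they contain the same sentences `K i
φ`. The heart is `exists_accessible`: if `K i φ ∉ Γ`, then `φ` is missing from some accessible
world. Let `S` be the set of `p` with `A_i^* p ∈ Γ`. All known sentences are over `S`. If `φ` is
over `S`, a world containing `¬φ` is needed; otherwise a world whose language omits some `p` of `φ`
suffices.

With quantifiers the difficulty is to supply counterexamples: every `p ∈ S` occurs in the known
sentences, so `S` has no fresh propositions. First decide `U = ∀x A_i^* x`. If `U` is added, the new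
language is `S`, which FA^* shows to be nonempty; if `¬U` is added, it is `S ∪ Q` with `Q` infinite,
new, and consisting of propositions with `¬A_i^* r`. Suppose a finite stage contains `¬∀y ψ` and no
instance over `S` can be refuted consistently. Then all these instances are derivable, and a Barcan
argument (`Der.barcan`, `der_imp_instance`) yields `A_i^* p ⇒ ψ[y/p]` for fresh `p`. Under `U` this
gives `ψ[y/p]` and hence `∀y ψ`, a contradiction. Under `¬U` it shows that `¬A_i^* p` and `¬ψ[y/p]`
can be added for a fresh `p ∈ Q`. Meeting countably many such requirements produces the world
(`exists_of_family`). -/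

namespace Awareness

namespace Formula

variable {n : ℕ} {Φ V : Type u}

/-! ### Formulas -/

/-- Induction on formulas in which the induction hypothesis of a quantified formula concerns its
instances by quantifier-free sentences. -/
theorem instanceInduction {motive : Formula n Φ V → Prop}
    (prim : ∀ p, motive (.prim p)) (var : ∀ x, motive (.var x))
    (neg : ∀ φ, motive φ → motive (.neg φ))
    (and : ∀ φ ψ, motive φ → motive ψ → motive (.and φ ψ))
    (K : ∀ i φ, motive φ → motive (.K i φ)) (A : ∀ i φ, motive φ → motive (.A i φ))
    (X : ∀ i φ, motive φ → motive (.X i φ))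
    (all : ∀ x φ, (∀ ψ, ψ.QuantFree → motive (φ.substVar x ψ)) → motive (.all x φ))
    (φ : Formula n Φ V) : motive φ := by
  suffices h : ∀ m (φ : Formula n Φ V), φ.numAll = m → motive φ from h _ φ rfl
  intro m
  induction m using Nat.strong_induction_on with
  | _ m IH =>
    -- Inner structural induction; the outer one is on the number of quantifiers, which
    -- instantiation by a quantifier-free sentence does not change.
    have key : ∀ φ : Formula n Φ V, φ.numAll ≤ m → motive φ := by
      intro φ
      induction φ with
      | prim p => exact fun _ => prim p
      | var x => exact fun _ => var x
      | neg φ ih => exact fun h => neg φ (ih h)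
      | and φ ψ ih₁ ih₂ =>
        intro h
        simp only [numAll] at h
        exact and φ ψ (ih₁ (by omega)) (ih₂ (by omega))
      | K i φ ih => exact fun h => K i φ (ih h)
      | A i φ ih => exact fun h => A i φ (ih h)
      | X i φ ih => exact fun h => X i φ (ih h)
      | all x φ _ =>
        intro h
        simp only [numAll] at h
        refine all x φ fun ψ hψ => IH φ.numAll (by omega) _ (numAll_substVar x hψ φ)
    exact fun φ h => key φ h.le

theorem QuantFree.free_eq_empty {φ : Formula n Φ V} (h : φ.QuantFree) : φ.free = ∅ := by
  induction φ <;> simp_all [QuantFree, free]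

/-- There are no propositional constants. Hence, without quantifiers, an agent who is star-aware of
no primitive proposition knows nothing. -/
theorem QuantFree.prims_nonempty {φ : Formula n Φ V} (h : φ.QuantFree) : φ.prims.Nonempty := by
  induction φ <;> simp_all [QuantFree, prims]

theorem finite_prims (φ : Formula n Φ V) : φ.prims.Finite := by
  induction φ <;> simp_all [prims]

theorem substVar_of_notMem_free {x : V} {φ : Formula n Φ V} (ψ : Formula n Φ V)
    (h : x ∉ φ.free) : φ.substVar x ψ = φ := by
  induction φ with
  | var y =>
    have hy : y ≠ x := fun hy => h hy.symm
    simp [substVar, hy]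
  | all y φ ih =>
    by_cases hy : y = x
    · simp [substVar, hy]
    · simp only [substVar, hy, if_false]
      rw [ih fun hx => h ⟨hx, fun h => hy h.symm⟩]
  | _ => simp_all [free, substVar]

theorem prims_substVar_subset (x : V) (φ ψ : Formula n Φ V) :
    (φ.substVar x ψ).prims ⊆ φ.prims ∪ ψ.prims := by
  induction φ with
  | var y => by_cases hy : y = x <;> simp [substVar, hy, prims]
  | all y φ ih => by_cases hy : y = x <;> simp_all [substVar, prims]
  | and φ χ ih₁ ih₂ =>
    simp only [substVar, prims]
    rintro p (hp | hp)
    · rcases ih₁ hp with h | h <;> simp [h]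
    · rcases ih₂ hp with h | h <;> simp [h]
  | _ => simp_all [substVar, prims]

theorem prims_subset_of_mem_free {x : V} {φ : Formula n Φ V} (ψ : Formula n Φ V)
    (h : x ∈ φ.free) : ψ.prims ⊆ (φ.substVar x ψ).prims := by
  induction φ with
  | var y => simp_all [free, substVar]
  | all y φ ih =>
    have hy : y ≠ x := fun hy => h.2 hy.symm
    simpa [substVar, hy, prims] using ih h.1
  | and φ χ ih₁ ih₂ =>
    rcases h with h | h
    · exact (ih₁ h).trans Set.subset_union_left
    · exact (ih₂ h).trans Set.subset_union_right
  | _ => simp_all [free, substVar, prims]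

theorem free_substVar {ψ : Formula n Φ V} (hψ : ψ.free = ∅) (x : V) (φ : Formula n Φ V) :
    (φ.substVar x ψ).free = φ.free \ {x} := by
  induction φ with
  | var y =>
    by_cases hy : y = x
    · simp [substVar, hy, free, hψ]
    · simp only [substVar, hy, if_false, free]
      exact (Set.sdiff_singleton_eq_self fun h => hy h.symm).symm
  | all y φ ih =>
    by_cases hy : y = x
    · simp [substVar, hy, free]
    · simp only [substVar, hy, if_false, free, ih]
      ext z
      simp [and_right_comm]
  | and φ χ ih₁ ih₂ => simp [substVar, free, ih₁, ih₂, Set.union_sdiff_distrib]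
  | _ => simp_all [free, substVar]

theorem KOnly.substVar {φ ψ : Formula n Φ V} (hφ : φ.KOnly) (hψ : ψ.KOnly) (x : V) :
    (φ.substVar x ψ).KOnly := by
  induction φ with
  | var y => by_cases hy : y = x <;> simp [Formula.substVar, hy, hψ, KOnly]
  | all y φ ih => by_cases hy : y = x <;> simp_all [Formula.substVar, KOnly]
  | _ => simp_all [Formula.substVar, KOnly]

/-- In 1_∀ only the whole axiom is required to lie in the language; this recovers that the
instantiating sentence does too. -/
theorem KOnly.of_substVar {x : V} {φ ψ : Formula n Φ V} (h : x ∈ φ.free)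
    (hφ : (φ.substVar x ψ).KOnly) : ψ.KOnly := by
  induction φ with
  | var y => simp_all [free, Formula.substVar]
  | all y φ ih =>
    have hy : y ≠ x := fun hy => h.2 hy.symm
    simp only [Formula.substVar, hy, if_false] at hφ
    exact ih h.1 hφ
  | and φ χ ih₁ ih₂ =>
    rcases h with h | h
    · exact ih₁ h hφ.1
    · exact ih₂ h hφ.2
  | _ => simp_all [free, Formula.substVar, KOnly]

/-! ### Exchanging primitive propositions and variables -/

theorem substPrim_of_notMem_prims {q : Φ} {φ : Formula n Φ V} (ψ : Formula n Φ V)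
    (h : q ∉ φ.prims) : φ.substPrim q ψ = φ := by
  induction φ with
  | prim p =>
    have hp : p ≠ q := fun hp => h hp.symm
    simp [substPrim, hp]
  | _ => simp_all [substPrim, prims]

theorem prims_substPrim_var (q : Φ) (x : V) (φ : Formula n Φ V) :
    (φ.substPrim q (var x)).prims = φ.prims \ {q} := by
  induction φ with
  | prim p =>
    by_cases hp : p = q
    · simp [substPrim, hp, prims]
    · simp only [substPrim, hp, if_false, prims]
      exact (Set.sdiff_singleton_eq_self fun h => hp h.symm).symm
  | and φ χ ih₁ ih₂ => simp [substPrim, prims, ih₁, ih₂, Set.union_sdiff_distrib]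
  | _ => simp_all [substPrim, prims]

theorem free_substPrim_var_subset (q : Φ) (x : V) (φ : Formula n Φ V) :
    (φ.substPrim q (var x)).free ⊆ φ.free ∪ {x} := by
  induction φ with
  | prim p => by_cases hp : p = q <;> simp [substPrim, hp, free]
  | and φ χ ih₁ ih₂ =>
    simp only [substPrim, free]
    rintro p (hp | hp)
    · rcases ih₁ hp with h | h
      · exact .inl (.inl h)
      · exact .inr h
    · rcases ih₂ hp with h | h
      · exact .inl (.inr h)
      · exact .inr h
  | all y φ ih =>
    simp only [substPrim, free]
    rintro p ⟨hp, hy⟩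
    rcases ih hp with h | h
    · exact .inl ⟨h, hy⟩
    · exact .inr h
  | _ => simp_all [substPrim, free]

theorem KOnly.substPrim_var {φ : Formula n Φ V} (h : φ.KOnly) (q : Φ) (x : V) :
    (φ.substPrim q (.var x)).KOnly := by
  induction φ with
  | prim p => by_cases hp : p = q <;> simp [substPrim, hp, KOnly]
  | _ => simp_all [substPrim, KOnly]

theorem substitutable_of_notMem_prims (x : V) {q : Φ} {φ : Formula n Φ V} (h : q ∉ φ.prims) :
    φ.Substitutable x q := by
  induction φ <;> simp_all [Substitutable, prims]

theorem substitutable_substVar_prim (x : V) {q : Φ} {φ : Formula n Φ V} (h : q ∉ φ.prims) :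
    (φ.substVar x (prim q)).Substitutable x q := by
  induction φ with
  | var y => by_cases hy : y = x <;> simp [substVar, hy, Substitutable]
  | all y φ ih =>
    by_cases hy : y = x
    · simp only [substVar, hy, if_true]
      exact ⟨fun _ => h, substitutable_of_notMem_prims x h⟩
    · simp only [substVar, hy, if_false]
      exact ⟨fun h => (hy h).elim, ih h⟩
  | _ => simp_all [substVar, Substitutable, prims]

/-- With this, Gen_∀ passes from an instance at a fresh proposition to the universal sentence. -/
theorem substPrim_substVar_prim (x : V) {q : Φ} {φ : Formula n Φ V} (h : q ∉ φ.prims) :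
    (φ.substVar x (prim q)).substPrim q (var x) = φ := by
  induction φ with
  | prim p => simp_all [substVar, substPrim, prims, eq_comm]
  | var y => by_cases hy : y = x <;> simp [substVar, hy, substPrim]
  | all y φ ih =>
    by_cases hy : y = x
    · simp only [substVar, hy, if_true]
      exact substPrim_of_notMem_prims (φ := all x φ) _ h
    · simpa [substVar, hy, substPrim] using ih h
  | _ => simp_all [substVar, substPrim, prims]

/-- All variables that occur in a formula, free or bound. -/
def vars : Formula n Φ V → Set V
  | prim _ => ∅
  | var x => {x}
  | neg φ => vars φ
  | and φ ψ => vars φ ∪ vars ψ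
  | K _ φ => vars φ
  | A _ φ => vars φ
  | X _ φ => vars φ
  | all x φ => insert x (vars φ)

theorem finite_vars (φ : Formula n Φ V) : φ.vars.Finite := by
  induction φ <;> simp_all [vars]

theorem substitutable_of_notMem_vars {x : V} (q : Φ) {φ : Formula n Φ V} (h : x ∉ φ.vars) :
    φ.Substitutable x q := by
  induction φ <;> simp_all [Substitutable, vars, eq_comm]

/-- The reverse exchange: a proposition can be bound by an unused variable and later restored by
instantiation. -/
theorem substVar_substPrim_var {z : V} (q : Φ) {φ : Formula n Φ V} (h : z ∉ φ.vars) :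
    (φ.substPrim q (var z)).substVar z (prim q) = φ := by
  induction φ with
  | prim p => by_cases hp : p = q <;> simp [substVar, hp, substPrim]
  | var x =>
    have hx : x ≠ z := fun hx => h hx.symm
    simp [substVar, substPrim, hx]
  | all x φ ih =>
    have hx : x ≠ z := fun hx => h (.inl hx.symm)
    simp only [substVar, substPrim, hx, if_false]
    rw [ih fun hz => h (.inr hz)]
  | _ => simp_all [substVar, substPrim, vars]

theorem substVar_substPrim_comm {y z : V} {q : Φ} {θ : Formula n Φ V} (hyz : y ≠ z)
    (hq : q ∉ θ.prims) (φ : Formula n Φ V) :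
    (φ.substPrim q (var z)).substVar y θ = (φ.substVar y θ).substPrim q (var z) := by
  induction φ with
  | prim p => by_cases hp : p = q <;> simp [substVar, hp, substPrim, hyz.symm]
  | var x => by_cases hx : x = y <;> simp [substVar, hx, substPrim, substPrim_of_notMem_prims _ hq]
  | all x φ ih => by_cases hx : x = y <;> simp [substVar, hx, substPrim, ih]
  | _ => simp_all [substVar, substPrim]

theorem QuantFree.vars_eq_empty {φ : Formula n Φ V} (h : φ.QuantFree) : φ.vars = ∅ := by
  induction φ <;> simp_all [QuantFree, vars]

theorem vars_substVar_subset {θ : Formula n Φ V} (hθ : θ.QuantFree) (y : V)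
    (φ : Formula n Φ V) : (φ.substVar y θ).vars ⊆ φ.vars := by
  induction φ with
  | var x => by_cases hx : x = y <;> simp [substVar, hx, hθ.vars_eq_empty]
  | all x φ ih =>
    by_cases hx : x = y
    · simp [substVar, hx]
    · simpa [substVar, hx, vars] using Set.insert_subset_insert ih
  | and φ ψ ih₁ ih₂ => exact Set.union_subset_union ih₁ ih₂
  | _ => simp_all [substVar, vars]

/-- Simultaneous substitution for the primitive propositions. -/
def bind (σ : Φ → Formula n Φ V) : Formula n Φ V → Formula n Φ V
  | prim p => σ p
  | var x => var x
  | neg φ => neg (bind σ φ)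
  | and φ ψ => and (bind σ φ) (bind σ ψ)
  | K i φ => K i (bind σ φ)
  | A i φ => A i (bind σ φ)
  | X i φ => X i (bind σ φ)
  | all x φ => all x (bind σ φ)

theorem mem_prims_bind {σ : Φ → Formula n Φ V} {φ : Formula n Φ V} {r : Φ} :
    r ∈ (φ.bind σ).prims ↔ ∃ p ∈ φ.prims, r ∈ (σ p).prims := by
  induction φ with
  | and φ χ ih₁ ih₂ => simp only [bind, prims, Set.mem_union, ih₁, ih₂, or_and_right, exists_or]
  | _ => simp_all [bind, prims]

theorem prims_bind_subset {σ : Φ → Formula n Φ V} {φ : Formula n Φ V} {L : Set Φ} :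
    (φ.bind σ).prims ⊆ L ↔ ∀ p ∈ φ.prims, (σ p).prims ⊆ L := by
  simp only [Set.subset_def, mem_prims_bind]
  exact ⟨fun h p hp r hr => h r ⟨p, hp, hr⟩, fun h r ⟨p, hp, hr⟩ => h p hp r hr⟩

theorem free_bind {σ : Φ → Formula n Φ V} (hσ : ∀ p, (σ p).QuantFree) (φ : Formula n Φ V) :
    (φ.bind σ).free = φ.free := by
  induction φ with
  | prim p => simp [bind, free, (hσ p).free_eq_empty]
  | _ => simp_all [bind, free]

theorem QuantFree.bind {σ : Φ → Formula n Φ V} (hσ : ∀ p, (σ p).QuantFree) {φ : Formula n Φ V}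
    (h : φ.QuantFree) : (φ.bind σ).QuantFree := by
  induction φ <;> simp_all [Formula.bind, QuantFree]

theorem KOnly.bind {σ : Φ → Formula n Φ V} (hσ : ∀ p, (σ p).KOnly) {φ : Formula n Φ V}
    (h : φ.KOnly) : (φ.bind σ).KOnly := by
  induction φ <;> simp_all [Formula.bind, KOnly]

theorem bind_congr_prim {σ : Φ → Formula n Φ V} {φ : Formula n Φ V}
    (h : ∀ p ∈ φ.prims, σ p = prim p) : φ.bind σ = φ := by
  induction φ <;> simp_all [bind, prims]

theorem bind_bind (σ ρ : Φ → Formula n Φ V) (φ : Formula n Φ V) :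
    (φ.bind ρ).bind σ = φ.bind fun p => (ρ p).bind σ := by
  induction φ <;> simp_all [bind]

theorem bind_substVar {σ : Φ → Formula n Φ V} (hσ : ∀ p, (σ p).QuantFree) (x : V)
    (φ ψ : Formula n Φ V) : (φ.substVar x ψ).bind σ = (φ.bind σ).substVar x (ψ.bind σ) := by
  induction φ with
  | prim p =>
    rw [bind, substVar_of_notMem_free (φ := σ p) _ (by simp [(hσ p).free_eq_empty])]
    rfl
  | var y => by_cases hy : y = x <;> simp [substVar, hy, bind]
  | all y φ ih => by_cases hy : y = x <;> simp [substVar, hy, bind, ih]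
  | _ => simp_all [bind, substVar]

/-- An instance of the conclusion of Gen_∀ is a substitution instance of its premise.
Substitutability is what prevents capture: a subformula `∀x` does not contain `q`, so both sides
leave it alone. -/
theorem substVar_substPrim_eq_bind {σ : Φ → Formula n Φ V} {x : V} {q : Φ} {φ : Formula n Φ V}
    (hσ : ∀ p ∈ φ.prims, p ≠ q → σ p = prim p) (hx : φ.Substitutable x q) (hf : x ∉ φ.free) :
    (φ.substPrim q (var x)).substVar x (σ q) = φ.bind σ := by
  induction φ with
  | prim p => by_cases hp : p = q <;> simp_all [substVar, substPrim, bind, prims]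
  | var y => simp_all [substVar, substPrim, bind, free, eq_comm]
  | all y φ ih =>
    by_cases hy : y = x
    · have hq : q ∉ φ.prims := hx.1 hy
      rw [substPrim_of_notMem_prims _ (show q ∉ (all y φ).prims from hq)]
      rw [bind_congr_prim fun p hp => hσ p hp fun h => hq (h ▸ hp)]
      simp [substVar, hy]
    · have hf' : x ∉ φ.free := fun h => hf ⟨h, fun h => hy h.symm⟩
      simp only [substPrim, substVar, hy, if_false, bind]
      rw [ih hσ hx.2 hf']
  | and φ χ ih₁ ih₂ =>
    simp only [free, Set.mem_union, not_or] at hf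
    simp only [substPrim, substVar, bind]
    rw [ih₁ (fun p hp => hσ p (.inl hp)) hx.1 hf.1, ih₂ (fun p hp => hσ p (.inr hp)) hx.2 hf.2]
  | _ => simp_all [substVar, substPrim, bind, prims, free, Substitutable]

/-! ### Languages with flags -/

/-- The sentences of a language; `k` says that the operators `A i`, `X i` are missing, `q` says
that there is quantification. -/
def Lng (k q : Prop) (φ : Formula n Φ V) : Prop :=
  φ.IsSentence ∧ (k → φ.KOnly) ∧ (¬ q → φ.QuantFree)

/-- The quantifier-free sentences; `k` says that the operators `A i`, `X i` are missing. -/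
def Rng (n : ℕ) (Φ V : Type u) (k : Prop) : Set (Formula n Φ V) :=
  {φ | φ.QuantFree ∧ (k → φ.KOnly)}

section Lng

variable {k q : Prop}

@[simp] theorem lng_prim (p : Φ) : Lng k q (prim p : Formula n Φ V) := by
  simp [Lng, IsSentence, free, KOnly, QuantFree]

@[simp] theorem lng_neg {φ : Formula n Φ V} : Lng k q (neg φ) ↔ Lng k q φ := Iff.rfl

@[simp] theorem lng_K {i : Fin n} {φ : Formula n Φ V} : Lng k q (K i φ) ↔ Lng k q φ := Iff.rfl

@[simp] theorem lng_and {φ ψ : Formula n Φ V} :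
    Lng k q (and φ ψ) ↔ Lng k q φ ∧ Lng k q ψ := by
  simp only [Lng, IsSentence, free, KOnly, QuantFree, Set.union_empty_iff]
  tauto

@[simp] theorem lng_or {φ ψ : Formula n Φ V} : Lng k q (or φ ψ) ↔ Lng k q φ ∧ Lng k q ψ := by
  simp [or]

@[simp] theorem lng_imp {φ ψ : Formula n Φ V} : Lng k q (imp φ ψ) ↔ Lng k q φ ∧ Lng k q ψ := by
  simp [imp]

@[simp] theorem lng_iff {φ ψ : Formula n Φ V} : Lng k q (iff φ ψ) ↔ Lng k q φ ∧ Lng k q ψ := by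
  simp only [iff, lng_and, lng_imp]
  tauto

@[simp] theorem lng_Astar {i : Fin n} {φ : Formula n Φ V} : Lng k q (Astar i φ) ↔ Lng k q φ := by
  simp [Astar]

theorem lng_A {i : Fin n} {φ : Formula n Φ V} : Lng k q (A i φ) ↔ ¬ k ∧ Lng k q φ := by
  simp only [Lng, IsSentence, free, KOnly, QuantFree]
  tauto

theorem lng_X {i : Fin n} {φ : Formula n Φ V} : Lng k q (X i φ) ↔ ¬ k ∧ Lng k q φ := by
  simp only [Lng, IsSentence, free, KOnly, QuantFree]
  tauto

theorem not_lng_var {x : V} : ¬ Lng k q (var x : Formula n Φ V) := by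
  simp [Lng, IsSentence, free]

theorem lng_all {x : V} {φ : Formula n Φ V} :
    Lng k q (all x φ) ↔ q ∧ φ.free ⊆ {x} ∧ (k → φ.KOnly) := by
  simp only [Lng, IsSentence, free, KOnly, QuantFree, Set.sdiff_eq_empty]
  tauto

theorem lng_of_mem_rng {θ : Formula n Φ V} (h : θ ∈ Rng n Φ V k) : Lng k q θ :=
  ⟨h.1.free_eq_empty, h.2, fun _ => h.1⟩

@[simp] theorem prim_mem_rng (p : Φ) : (prim p : Formula n Φ V) ∈ Rng n Φ V k :=
  ⟨trivial, fun _ => trivial⟩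

theorem Lng.substVar {x : V} {φ θ : Formula n Φ V} (h : Lng k q (all x φ))
    (hθ : θ ∈ Rng n Φ V k) : Lng k q (φ.substVar x θ) := by
  rw [lng_all] at h
  refine ⟨?_, fun hk => (h.2.2 hk).substVar (hθ.2 hk) x, fun hq => (hq h.1).elim⟩
  rw [IsSentence, free_substVar hθ.1.free_eq_empty, Set.sdiff_eq_empty]
  exact h.2.1

theorem Lng.all_substPrim {φ : Formula n Φ V} (h : Lng k q φ) (hq : q) (x : V) (p : Φ) :
    Lng k q (all x (φ.substPrim p (var x))) := by
  rw [lng_all]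
  refine ⟨hq, ?_, fun hk => (h.2.1 hk).substPrim_var p x⟩
  have := free_substPrim_var_subset p x φ
  rwa [h.1, Set.empty_union] at this

end Lng

/-! ### Propositions and substitution in abbreviations -/

@[simp] theorem prims_or (φ ψ : Formula n Φ V) : (or φ ψ).prims = φ.prims ∪ ψ.prims := rfl

@[simp] theorem prims_imp (φ ψ : Formula n Φ V) : (imp φ ψ).prims = φ.prims ∪ ψ.prims := rfl

@[simp] theorem prims_iff (φ ψ : Formula n Φ V) : (iff φ ψ).prims = φ.prims ∪ ψ.prims := by
  simp only [iff, prims, prims_imp]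
  rw [Set.union_comm ψ.prims, Set.union_self]

@[simp] theorem prims_Astar (i : Fin n) (φ : Formula n Φ V) : (Astar i φ).prims = φ.prims := by
  simp [Astar, prims]

@[simp] theorem prims_verum (x : V) : (verum x : Formula n Φ V).prims = ∅ := by
  simp [verum, prims]

@[simp] theorem substVar_imp (x : V) (φ ψ θ : Formula n Φ V) :
    (imp φ ψ).substVar x θ = imp (φ.substVar x θ) (ψ.substVar x θ) := rfl

theorem substVar_neg (x : V) (φ θ : Formula n Φ V) :
    (neg φ).substVar x θ = neg (φ.substVar x θ) := rfl

theorem substVar_K (i : Fin n) (x : V) (φ θ : Formula n Φ V) :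
    (K i φ).substVar x θ = K i (φ.substVar x θ) := rfl

@[simp] theorem substVar_Astar (i : Fin n) (x : V) (φ θ : Formula n Φ V) :
    (Astar i φ).substVar x θ = Astar i (φ.substVar x θ) := rfl

@[simp] theorem substVar_var_self (x : V) (θ : Formula n Φ V) : (var x).substVar x θ = θ := by
  simp [substVar]

/-! ### Countability -/

/-- A numbering of the formulas. -/
def code (e : Φ → ℕ) (f : V → ℕ) : Formula n Φ V → ℕ
  | prim p => Nat.pair 0 (e p)
  | var x => Nat.pair 1 (f x)
  | neg φ => Nat.pair 2 (code e f φ)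
  | and φ ψ => Nat.pair 3 (Nat.pair (code e f φ) (code e f ψ))
  | K i φ => Nat.pair 4 (Nat.pair i (code e f φ))
  | A i φ => Nat.pair 5 (Nat.pair i (code e f φ))
  | X i φ => Nat.pair 6 (Nat.pair i (code e f φ))
  | all x φ => Nat.pair 7 (Nat.pair (f x) (code e f φ))

instance [Countable Φ] [Countable V] : Countable (Formula n Φ V) := by
  obtain ⟨e, he⟩ := exists_injective_nat Φ
  obtain ⟨f, hf⟩ := exists_injective_nat V
  refine Function.Injective.countable (f := code e f) fun φ => ?_
  induction φ with
  | prim p => intro ψ h; cases ψ <;> simp_all [code, Nat.pair_eq_pair, he.eq_iff]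
  | var x => intro ψ h; cases ψ <;> simp_all [code, Nat.pair_eq_pair, hf.eq_iff]
  | neg φ ih =>
    intro ψ h; cases ψ <;> simp [code, Nat.pair_eq_pair] at h; rw [ih h]
  | and φ χ ih₁ ih₂ =>
    intro ψ h; cases ψ <;> simp [code, Nat.pair_eq_pair] at h; rw [ih₁ h.1, ih₂ h.2]
  | K i φ ih =>
    intro ψ h; cases ψ <;> simp [code, Nat.pair_eq_pair] at h; rw [Fin.ext h.1, ih h.2]
  | A i φ ih =>
    intro ψ h; cases ψ <;> simp [code, Nat.pair_eq_pair] at h; rw [Fin.ext h.1, ih h.2]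
  | X i φ ih =>
    intro ψ h; cases ψ <;> simp [code, Nat.pair_eq_pair] at h; rw [Fin.ext h.1, ih h.2]
  | all x φ ih =>
    intro ψ h; cases ψ <;> simp [code, Nat.pair_eq_pair] at h; rw [hf h.1, ih h.2]

end Formula

end Awareness

namespace Awareness

open Formula

variable {n : ℕ} {Φ V : Type u}

/-! ### Truth -/

namespace ExtStructure

variable {M : ExtStructure n Φ V} {R : Set (Formula n Φ V)} {s : M.World}

/-- Used throughout to see that a sentence known at `s` is defined at all worlds accessible from
`s`. -/
theorem Sat.prims_subset {φ : Formula n Φ V} (h : M.Sat R s φ) : φ.prims ⊆ M.lang s := by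
  induction φ with
  | prim p => rw [Sat] at h; simpa [prims] using h.1
  | var x => simp [prims]
  | neg φ _ => rw [Sat] at h; exact h.1
  | and φ ψ ih₁ ih₂ => rw [Sat] at h; exact Set.union_subset (ih₁ h.1) (ih₂ h.2)
  | K i φ _ => rw [Sat] at h; exact h.1
  | A i φ _ => rw [Sat] at h; exact h.1
  | X i φ _ => rw [Sat] at h; exact h.1.1
  | all x φ _ => rw [Sat] at h; exact h.1

theorem sat_neg {φ : Formula n Φ V} (h : φ.prims ⊆ M.lang s) :
    M.Sat R s (neg φ) ↔ ¬ M.Sat R s φ := by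
  rw [Sat]
  exact and_iff_right h

theorem sat_and {φ ψ : Formula n Φ V} :
    M.Sat R s (and φ ψ) ↔ M.Sat R s φ ∧ M.Sat R s ψ := by
  rw [Sat]

theorem sat_or {φ ψ : Formula n Φ V} (hφ : φ.prims ⊆ M.lang s) (hψ : ψ.prims ⊆ M.lang s) :
    M.Sat R s (or φ ψ) ↔ M.Sat R s φ ∨ M.Sat R s ψ := by
  rw [Formula.or, sat_neg (by exact Set.union_subset hφ hψ), sat_and, sat_neg hφ, sat_neg hψ]
  tauto

theorem sat_imp {φ ψ : Formula n Φ V} (hφ : φ.prims ⊆ M.lang s) (hψ : ψ.prims ⊆ M.lang s) :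
    M.Sat R s (imp φ ψ) ↔ (M.Sat R s φ → M.Sat R s ψ) := by
  rw [imp, sat_or (by exact hφ) hψ, sat_neg hφ]
  tauto

theorem sat_iff {φ ψ : Formula n Φ V} (hφ : φ.prims ⊆ M.lang s) (hψ : ψ.prims ⊆ M.lang s) :
    M.Sat R s (iff φ ψ) ↔ (M.Sat R s φ ↔ M.Sat R s ψ) := by
  rw [iff, sat_and, sat_imp hφ hψ, sat_imp hψ hφ]
  tauto

theorem sat_K {i : Fin n} {φ : Formula n Φ V} (h : φ.prims ⊆ M.lang s) :
    M.Sat R s (K i φ) ↔ ∀ t, M.rel i s t → M.Sat R t φ := by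
  rw [Sat]
  exact and_iff_right h

theorem sat_A {i : Fin n} {φ : Formula n Φ V} :
    M.Sat R s (A i φ) ↔ φ ∈ M.aware i s := by
  rw [Sat]
  exact and_iff_right_of_imp fun h => M.aware_lang _ _ _ h

theorem sat_all {x : V} {φ : Formula n Φ V} (h : φ.prims ⊆ M.lang s) :
    M.Sat R s (all x φ) ↔ ∀ ψ : Formula n Φ V, ψ.QuantFree → ψ ∈ R → ψ.prims ⊆ M.lang s →
        M.Sat R s (φ.substVar x ψ) := by
  rw [Sat]
  exact and_iff_right h

/-- `φ ∨ ¬φ` is true exactly where `φ` is defined, so star-awareness is definedness at all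
accessible worlds. -/
theorem sat_Astar {i : Fin n} {φ : Formula n Φ V} (h : φ.prims ⊆ M.lang s) :
    M.Sat R s (Astar i φ) ↔ ∀ t, M.rel i s t → φ.prims ⊆ M.lang t := by
  rw [Astar, sat_K (by simpa [prims] using h)]
  refine forall₂_congr fun t _ => ⟨fun ht => ?_, fun ht => ?_⟩
  · simpa [prims] using ht.prims_subset
  · rw [sat_or ht (by exact ht), sat_neg ht]
    exact em _

theorem sat_verum (x : V) : M.Sat R s (verum x) := by
  rw [verum, sat_all (by simp [prims])]
  intro ψ hψ _ hs
  simp only [Formula.or, substVar, if_true]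
  rw [sat_neg (by exact Set.union_subset hs hs), sat_and, sat_neg hs, sat_neg (by exact hs),
    sat_neg hs]
  tauto

theorem sat_conj {x : V} {l : List (Formula n Φ V)} :
    M.Sat R s (conj x l) ↔ ∀ φ ∈ l, M.Sat R s φ := by
  induction l using conj.induct with
  | case1 => simpa [conj] using sat_verum x
  | case2 φ => simp [conj]
  | case3 φ ψ l ih => simp only [conj, sat_and, ih, List.forall_mem_cons]

end ExtStructure

/-! ### Pulling back a structure along a substitution -/

namespace ExtStructure

open Classical in
/-- The structure in which the primitive proposition `p` has the meaning of `σ p` in `M`. The map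
`τ` selects, for every `r`, a primitive proposition with the meaning of `r`. -/
noncomputable abbrev pullback (M : ExtStructure n Φ V) (R : Set (Formula n Φ V))
    (σ : Φ → Formula n Φ V) (τ : Φ → Φ) (hτ : ∀ r, σ (τ r) = prim r) :
    ExtStructure n Φ V where
  World := M.World
  lang s := {p | (σ p).prims ⊆ M.lang s}
  lang_nonempty s := by
    obtain ⟨r, hr⟩ := M.lang_nonempty s
    exact ⟨τ r, by simpa [hτ, prims] using hr⟩
  val s p := decide (M.Sat R s (σ p))
  rel := M.rel
  aware i s := {φ | φ.IsSentence ∧ φ.bind σ ∈ M.aware i s}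
  aware_sentence _ _ _ h := h.1
  aware_lang i s φ h p hp := prims_bind_subset.1 (M.aware_lang _ _ _ h.2) p hp

variable {M : ExtStructure n Φ V} {k : Prop} {σ : Φ → Formula n Φ V} {τ : Φ → Φ}

/-- Only the quantifier needs an argument: the two structures have different ranges of instances,
which `σ` and `τ` match with each other. -/
theorem sat_pullback (hτ : ∀ r, σ (τ r) = prim r) (hσ : ∀ p, σ p ∈ Rng n Φ V k)
    (s : M.World) (φ : Formula n Φ V) :
    (M.pullback (Rng n Φ V k) σ τ hτ).Sat (Rng n Φ V k) s φ ↔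
      M.Sat (Rng n Φ V k) s (φ.bind σ) := by
  have hlang : ∀ (s : M.World) (φ : Formula n Φ V),
      φ.prims ⊆ (M.pullback (Rng n Φ V k) σ τ hτ).lang s ↔ (φ.bind σ).prims ⊆ M.lang s :=
    fun s φ => prims_bind_subset.symm
  have haware : ∀ (i : Fin n) (s : M.World) (φ : Formula n Φ V),
      φ ∈ (M.pullback (Rng n Φ V k) σ τ hτ).aware i s ↔ φ.bind σ ∈ M.aware i s := by
    refine fun i s φ => and_iff_right_of_imp fun h => ?_
    have := M.aware_sentence _ _ _ h
    rwa [IsSentence, free_bind fun p => (hσ p).1] at this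
  induction φ using instanceInduction generalizing s with
  | prim p =>
    rw [Formula.bind, Sat.eq_1]
    simp only [Set.mem_ofPred_eq, decide_eq_true_eq]
    exact and_iff_right_of_imp fun h => h.prims_subset
  | var x => rw [Formula.bind, Sat, Sat]
  | neg φ ih =>
    rw [Formula.bind, Sat, Sat, hlang]
    exact and_congr_right fun _ => not_congr (ih s)
  | and φ ψ ih₁ ih₂ =>
    rw [Formula.bind, Sat, Sat]
    exact and_congr (ih₁ s) (ih₂ s)
  | K i φ ih =>
    rw [Formula.bind, Sat, Sat, hlang]
    exact and_congr_right fun _ => forall_congr' fun t => imp_congr_right fun _ => ih t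
  | A i φ ih => rw [Formula.bind, Sat, Sat, hlang, haware]
  | X i φ ih =>
    rw [Formula.bind, Sat, Sat, hlang, haware]
    exact and_congr_right fun _ => and_congr_right fun _ =>
      forall_congr' fun t => imp_congr_right fun _ => ih t
  | all x φ ih =>
    rw [Formula.bind, Sat, Sat, hlang]
    refine and_congr_right fun _ => ⟨fun h ψ hψ hR hs => ?_, fun h ψ hψ hR hs => ?_⟩
    -- Each instance `ψ` available in `M` is the `σ`-image of its renaming along `τ`.
    · have hbind : (ψ.bind fun r => prim (τ r)).bind σ = ψ := by
        rw [bind_bind]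
        exact bind_congr_prim fun p _ => hτ p
      have hq : (ψ.bind fun r => prim (τ r)).QuantFree := hψ.bind (σ := fun r => prim (τ r)) fun _ => trivial
      have := h (ψ.bind fun r => prim (τ r)) hq
        ⟨hq, fun hk => (hR.2 hk).bind (σ := fun r => prim (τ r)) fun _ => trivial⟩ (by rwa [hlang, hbind])
      replace this := (ih _ hq s).1 this
      rwa [bind_substVar (fun p => (hσ p).1), hbind] at this
    · refine (ih _ hψ s).2 ?_
      rw [bind_substVar fun p => (hσ p).1]
      exact h _ (hψ.bind fun p => (hσ p).1)
        ⟨hψ.bind fun p => (hσ p).1, fun hk => (hR.2 hk).bind fun p => (hσ p).2 hk⟩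
        ((hlang _ _).1 hs)

theorem IsNrte.pullback (hM : M.IsNrte) (hτ : ∀ r, σ (τ r) = prim r)
    (hσ : ∀ p, σ p ∈ Rng n Φ V k) : (M.pullback (Rng n Φ V k) σ τ hτ).IsNrte where
  agpp i s φ hφ := by
    have hsent : ∀ φ : Formula n Φ V, φ.IsSentence → (φ.bind σ).IsSentence := fun φ h => by
      rwa [IsSentence, free_bind fun p => (hσ p).1]
    simp only [Set.mem_ofPred_eq, hφ, true_and]
    rw [hM.agpp i s _ (hsent _ hφ)]
    refine ⟨fun h p hp => ⟨rfl, ?_⟩, fun h r hr => ?_⟩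
    · rw [hM.agpp i s _ (hsent (prim p) rfl)]
      exact fun r hr => h r (mem_prims_bind.2 ⟨p, hp, by simpa [Formula.bind] using hr⟩)
    · obtain ⟨p, hp, hr⟩ := mem_prims_bind.1 hr
      exact (hM.agpp i s _ (hsent (prim p) rfl)).1 (h p hp).2 r hr
  ka i s t h := by
    simp only
    rw [hM.ka i s t h]
  refl := hM.refl
  trans := hM.trans
  eucl := hM.eucl

end ExtStructure

open Classical in
/-- A substitution that is prescribed on a finite set can be chosen such that every primitive
proposition is the image of a primitive proposition. -/
theorem exists_substitution [Countable Φ] [Infinite Φ] {k : Prop} {F : Set Φ} (hF : F.Finite)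
    (g : Φ → Formula n Φ V) (hg : ∀ p, g p ∈ Rng n Φ V k) :
    ∃ (σ : Φ → Formula n Φ V) (τ : Φ → Φ), (∀ p, σ p ∈ Rng n Φ V k) ∧ (∀ p ∈ F, σ p = g p) ∧
      ∀ r, σ (τ r) = prim r := by
  -- The complement of `F` is still in bijection with `Φ`; `τ` is this bijection and `σ` inverts it
  -- off `F`.
  have : Infinite ↥(Fᶜ) := hF.infinite_compl.to_subtype
  obtain ⟨e⟩ := nonempty_equiv_of_countable (α := Φ) (β := ↥(Fᶜ))
  refine ⟨fun p => if h : p ∈ F then g p else prim (e.symm ⟨p, h⟩), fun r => e r, fun p => ?_,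
    fun p hp => by simp [hp], fun r => ?_⟩
  · by_cases h : p ∈ F <;> simp [h, hg]
  · have h : (e r : Φ) ∉ F := (e r).2
    simp [h]

/-! ### The axiom systems with flags -/

/-- The axioms; `k` says that the operators `A i`, `X i` are missing, `q` says that there is
quantification. -/
def Ax (n : ℕ) (Φ V : Type u) (k q : Prop) : Set (Formula n Φ V) :=
  {φ | (φ ∈ schemesK n Φ V ∨ (q ∧ φ ∈ schemesAllK n Φ V) ∨
    (¬ k ∧ φ ∈ axAGPP n Φ V ∪ axKA n Φ V ∪ axA0 n Φ V)) ∧ Lng k q φ}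

/-- Provability from `Ax n Φ V k q`. -/
def Pr (k q : Prop) (φ : Formula n Φ V) : Prop := Provable (Ax n Φ V k q) q φ

theorem Pr.lng {k q : Prop} {φ : Formula n Φ V} (h : Pr k q φ) : Lng k q φ := by
  induction h with
  | ax h => exact h.2
  | mp _ _ _ ih => exact (lng_imp.1 ih).2
  | genStar i _ ih => simpa using ih
  | genAll hq x p hx _ ih => exact ih.all_substPrim hq x p

/-! ### Soundness -/

section Soundness

variable {M : ExtStructure n Φ V} {s : M.World} {R : Set (Formula n Φ V)} {k q : Prop}

open ExtStructure

open Classical in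
theorem sat_inst {σ : ℕ → Formula n Φ V} {θ : PropForm} (h : (θ.inst σ).prims ⊆ M.lang s) :
    M.Sat R s (θ.inst σ) ↔ θ.eval (fun m => decide (M.Sat R s (σ m))) = true := by
  induction θ with
  | atom m => simp [PropForm.inst, PropForm.eval]
  | neg θ ih =>
    rw [PropForm.inst, sat_neg (by exact h), ih h]
    simp [PropForm.eval]
  | and θ η ih₁ ih₂ =>
    rw [PropForm.inst, sat_and, ih₁ (Set.subset_union_left.trans h),
      ih₂ (Set.subset_union_right.trans h)]
    simp [PropForm.eval]

theorem sat_schemesK (hM : M.IsNrte) {χ : Formula n Φ V} (h : χ ∈ schemesK n Φ V)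
    (hs : χ.prims ⊆ M.lang s) : M.Sat R s χ := by
  rcases h with (((((h | h) | h) | h) | h) | h) | h
  · obtain ⟨θ, σ, hθ, rfl⟩ := h
    rw [sat_inst hs]
    exact hθ _
  · obtain ⟨i, φ, l, x, -, hl, rfl⟩ := h
    rw [prims_iff, prims_Astar, Set.union_subset_iff] at hs
    rw [sat_iff (by simpa using hs.1) hs.2, sat_Astar hs.1, sat_conj]
    simp only [List.forall_mem_map, hl]
    refine ⟨fun h p hp => ?_, fun h t ht p hp => ?_⟩
    · rw [sat_Astar (by simpa [prims] using hs.1 hp)]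
      exact fun t ht => by simpa [prims] using h t ht hp
    · have := h p hp
      rw [sat_Astar (by simpa [prims] using hs.1 hp)] at this
      simpa [prims] using this t ht
  · obtain ⟨i, φ, ψ, rfl⟩ := h
    simp only [prims_imp, prims, Set.union_subset_iff] at hs
    rw [sat_imp (by simp [prims, hs]) (by simp [prims, hs]), sat_and, sat_K hs.2,
      sat_K hs.1.1, sat_K (by simp [hs])]
    rintro ⟨h₁, h₂⟩ t ht
    have h₃ := (h₂ t ht).prims_subset
    rw [prims_imp, Set.union_subset_iff] at h₃
    exact (sat_imp h₃.1 h₃.2).1 (h₂ t ht) (h₁ t ht)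
  · obtain ⟨i, φ, rfl⟩ := h
    simp only [prims_imp, prims, prims_Astar, Set.union_self] at hs
    rw [sat_imp (by exact hs) (by simpa using hs), sat_K hs, sat_Astar hs]
    exact fun h t ht => (h t ht).prims_subset
  · obtain ⟨i, φ, rfl⟩ := h
    simp only [prims_imp, prims, Set.union_self] at hs
    rw [sat_imp (by exact hs) hs, sat_K hs]
    exact fun h => h s (hM.refl i s)
  · obtain ⟨i, φ, rfl⟩ := h
    simp only [prims_imp, prims, Set.union_self] at hs
    rw [sat_imp (by exact hs) (by exact hs), sat_K hs, sat_K (by exact hs)]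
    intro h t ht
    rw [sat_K (h t ht).prims_subset]
    exact fun u hu => h u (hM.trans i s t u ht hu)
  · obtain ⟨i, φ, rfl⟩ := h
    simp only [prims_imp, prims, prims_Astar, Set.union_self] at hs
    rw [sat_imp (by simpa [prims] using hs) (by exact hs), sat_and, sat_neg (by exact hs), sat_K hs,
      sat_Astar hs, sat_K (by exact hs)]
    rintro ⟨h₁, h₂⟩ t ht
    rw [sat_neg (by exact h₂ t ht), sat_K (h₂ t ht)]
    exact fun h => h₁ fun u hu => h u (hM.eucl i s t u ht hu)

theorem sat_schemesAllK (hM : M.IsNrte) {χ : Formula n Φ V} (h : χ ∈ schemesAllK n Φ V)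
    (hL : Lng k q χ) (hs : χ.prims ⊆ M.lang s) : M.Sat (Rng n Φ V k) s χ := by
  have hsymm : ∀ i s t, M.rel i s t → M.rel i t s :=
    fun i s t h => hM.eucl i s t s h (hM.refl i s)
  rcases h with ((((h | h) | h) | h) | h) | h
  · exact sat_schemesK hM h hs
  · obtain ⟨x, φ, ψ, hψ, rfl⟩ := h
    rw [prims_imp, Set.union_subset_iff] at hs
    rw [sat_imp hs.1 hs.2, sat_all (by exact hs.1)]
    intro h
    by_cases hx : x ∈ φ.free
    · exact h ψ hψ ⟨hψ, fun hk => ((lng_imp.1 hL).2.2.1 hk).of_substVar hx⟩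
        ((prims_subset_of_mem_free ψ hx).trans hs.2)
    -- If `x` is not free, `ψ` itself may be undefined at `s` or outside the range of the
    -- quantifier, but any instance will do. This is where nonempty languages matter.
    · obtain ⟨p, hp⟩ := M.lang_nonempty s
      have := h (prim p) trivial (prim_mem_rng p) (by simpa [prims] using hp)
      rwa [substVar_of_notMem_free _ hx] at this ⊢
  · obtain ⟨x, φ, ψ, rfl⟩ := h
    simp only [prims_imp, prims, Set.union_subset_iff] at hs
    rw [sat_imp (by simp [prims, hs]) (by simp [prims, hs]), sat_imp (by exact hs.1.1) (by exact hs.1.2),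
      sat_all (by simp [hs]), sat_all hs.1.1, sat_all hs.1.2]
    intro h₁ h₂ θ hθ hR hsθ
    have h₃ := h₁ θ hθ hR hsθ
    have h₄ := h₃.prims_subset
    rw [substVar_imp] at h₃ h₄
    rw [prims_imp, Set.union_subset_iff] at h₄
    exact (sat_imp h₄.1 h₄.2).1 h₃ (h₂ θ hθ hR hsθ)
  · obtain ⟨x, φ, hx, rfl⟩ := h
    simp only [prims_imp, prims, Set.union_self] at hs
    rw [sat_imp hs (by exact hs), sat_all hs]
    intro h θ _ _ _
    rwa [substVar_of_notMem_free _ hx]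
  · obtain ⟨i, x, φ, rfl⟩ := h
    have hs' : φ.prims ⊆ M.lang s := by
      simpa [prims] using hs
    rw [sat_imp (by simpa [prims] using hs') (by simpa [prims] using hs'), sat_and,
      sat_Astar (by exact hs'), sat_all (by simpa [prims] using hs'), sat_K (by simpa [prims] using hs')]
    rintro ⟨h₁, h₂⟩ t ht
    rw [sat_imp (by simp [prims]) (h₁ t ht), sat_all (by simp [prims]), sat_all (by exact h₁ t ht)]
    intro h₃ θ hθ hR hsθ
    have h₄ := h₃ θ hθ hR hsθ
    simp only [substVar_Astar, substVar_var_self] at h₄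
    rw [sat_Astar hsθ] at h₄
    -- By symmetry `s` is accessible from `t`, so star-awareness of `θ` at `t` makes `θ` defined at
    -- `s` and hence an instance there.
    have hθs := h₄ s (hsymm i s t ht)
    have h₅ := h₂ θ hθ hR hθs
    have h₆ := h₅.prims_subset
    simp only [substVar_imp, substVar_Astar, substVar_var_self, substVar_K, prims_imp, prims,
      prims_Astar, Set.union_subset_iff] at h₅ h₆
    rw [sat_imp (by simpa using h₆.1) (by exact h₆.2), sat_Astar hθs, sat_K h₆.2] at h₅
    exact h₅ (fun u hu => h₄ u (hM.trans i t s u (hsymm i s t ht) hu)) t ht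
  · obtain ⟨i, x, rfl⟩ := h
    rw [sat_imp (by simp [prims]) (by simp [prims]), sat_K (by simp [prims]),
      sat_all (by simp [prims])]
    intro h t ht
    rw [sat_all (by simp [prims])]
    intro θ hθ hR hsθ
    simp only [substVar_neg, substVar_Astar, substVar_var_self] at h ⊢
    rw [sat_neg (by simpa using hsθ), sat_Astar hsθ]
    intro h'
    have hθs := h' s (hsymm i s t ht)
    refine (sat_neg (by simpa using hθs)).1 (h θ hθ hR hθs) ((sat_Astar hθs).2 fun u hu => ?_)
    exact h' u (hM.trans i t s u (hsymm i s t ht) hu)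

theorem sat_awareness (hM : M.IsNrte) {χ : Formula n Φ V}
    (h : χ ∈ axAGPP n Φ V ∪ axKA n Φ V ∪ axA0 n Φ V)
    (hL : Lng k q χ) (hs : χ.prims ⊆ M.lang s) : M.Sat R s χ := by
  rcases h with (h | h) | h
  · obtain ⟨i, φ, l, x, -, hl, rfl⟩ := h
    rw [prims_iff, Set.union_subset_iff] at hs
    rw [sat_iff hs.1 hs.2, sat_A, sat_conj, hM.agpp i s φ (lng_A.1 (lng_iff.1 hL).1).2.1]
    simp only [List.forall_mem_map, hl, sat_A]
  · obtain ⟨i, φ, rfl⟩ := h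
    simp only [prims_imp, prims, Set.union_self] at hs
    rw [sat_imp (by exact hs) (by exact hs), sat_A, sat_K (by exact hs)]
    intro h t ht
    rwa [sat_A, ← hM.ka i s t ht]
  · obtain ⟨i, φ, rfl⟩ := h
    simp only [prims_iff, prims, Set.union_self] at hs
    rw [sat_iff (by exact hs) (by simpa [prims] using hs), sat_and, sat_A, sat_K hs, Sat]
    simp only [hs, true_and]
    tauto

/-- Soundness of the axiom systems. -/
theorem Pr.valid [Countable Φ] [Infinite Φ] {φ : Formula n Φ V} (h : Pr k q φ) :
    Valid (Rng n Φ V k) φ := by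
  induction h with
  | ax h =>
    intro M hM s hs
    rcases h.1 with h' | ⟨-, h'⟩ | ⟨-, h'⟩
    · exact sat_schemesK hM h' hs
    · exact sat_schemesAllK hM h' h.2 hs
    · exact sat_awareness hM h' h.2 hs
  | @mp φ ψ h₁ h₂ ih₁ ih₂ =>
    intro M hM s hs
    classical
    -- Propositions of `φ` outside `ψ` may be undefined at `s`; `σ` redirects them to `p₀` and fixes
    -- `ψ`, so both premises apply in the pullback.
    obtain ⟨p₀, hp₀⟩ := M.lang_nonempty s
    obtain ⟨σ, τ, hσ, hg, hτ⟩ := exists_substitution (k := k) (n := n) (V := V)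
      (φ.finite_prims.union ψ.finite_prims)
      (fun p => if p ∈ ψ.prims then prim p else prim p₀) (fun p => by split_ifs <;> simp)
    have hψ : ψ.bind σ = ψ := bind_congr_prim fun p hp => by simp [hg p (.inr hp), hp]
    have hsub : ∀ p ∈ φ.prims ∪ ψ.prims, (σ p).prims ⊆ M.lang s := by
      intro p hp
      rw [hg p hp]
      split_ifs with h
      · simpa [prims] using hs h
      · simpa [prims] using hp₀
    have hM' := hM.pullback hτ hσ
    have hφ' := ih₁ _ hM' s fun p hp => hsub p (.inl hp)
    have hi' := ih₂ _ hM' s hsub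
    rw [sat_imp (by exact fun p hp => hsub p (.inl hp)) (by exact fun p hp => hsub p (.inr hp))]
      at hi'
    have := hi' hφ'
    rwa [sat_pullback hτ hσ, hψ] at this
  | @genStar i φ h ih =>
    intro M hM s hs
    simp only [prims_imp, prims_Astar, prims, Set.union_self] at hs
    rw [sat_imp (by simpa using hs) (by exact hs), sat_Astar hs, sat_K hs]
    exact fun h t ht => ih M hM t (h t ht)
  | @genAll hq x p φ hx h ih =>
    intro M hM s hs
    classical
    rw [sat_all (by exact hs)]
    intro ψ hψ hR hψs
    -- The instance at `ψ` becomes the premise `φ` evaluated in the structure where `p` means `ψ`.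
    obtain ⟨σ, τ, hσ, hg, hτ⟩ := exists_substitution (k := k) (n := n) (V := V)
      (φ.finite_prims.union (Set.finite_singleton p))
      (fun r => if r = p then ψ else prim r) (fun r => by split_ifs <;> simp [hR])
    have hp : σ p = ψ := by simp [hg p (.inr rfl)]
    rw [← hp, substVar_substPrim_eq_bind (fun r hr hrp => by simp [hg r (.inl hr), hrp]) hx
      (by rw [(Pr.lng h).1]; exact Set.notMem_empty x), ← sat_pullback hτ hσ]
    refine ih _ (hM.pullback hτ hσ) s fun r hr => ?_
    simp only [Set.mem_ofPred_eq, hg r (.inl hr)]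
    split_ifs with h
    · exact hψs
    · have : r ∈ (all x (φ.substPrim p (var x))).prims := by
        rw [prims, prims_substPrim_var]
        exact ⟨hr, h⟩
      simpa [prims] using hs this

end Soundness

end Awareness

namespace Awareness

open Formula

variable {n : ℕ} {Φ V : Type u}

/-! ### Propositional reasoning -/

/-- A valuation of all formulas that respects the propositional connectives. -/
structure IsBoolean (v : Formula n Φ V → Prop) : Prop where
  neg : ∀ φ, v (neg φ) ↔ ¬ v φ
  and : ∀ φ ψ, v (and φ ψ) ↔ v φ ∧ v ψ

namespace IsBoolean

variable {v : Formula n Φ V → Prop}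

theorem or (hv : IsBoolean v) (φ ψ : Formula n Φ V) : v (or φ ψ) ↔ v φ ∨ v ψ := by
  rw [Formula.or, hv.neg, hv.and, hv.neg, hv.neg]
  tauto

theorem imp (hv : IsBoolean v) (φ ψ : Formula n Φ V) : v (imp φ ψ) ↔ (v φ → v ψ) := by
  rw [Formula.imp, hv.or, hv.neg]
  tauto

theorem iff (hv : IsBoolean v) (φ ψ : Formula n Φ V) : v (iff φ ψ) ↔ (v φ ↔ v ψ) := by
  rw [Formula.iff, hv.and, hv.imp, hv.imp]
  tauto

end IsBoolean

/-- The propositional skeleton of a formula; the atoms are numbered by `e`. -/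
def skeleton (e : Formula n Φ V → ℕ) : Formula n Φ V → PropForm
  | .neg φ => .neg (skeleton e φ)
  | .and φ ψ => .and (skeleton e φ) (skeleton e ψ)
  | .prim p => .atom (e (.prim p))
  | .var x => .atom (e (.var x))
  | .K i φ => .atom (e (.K i φ))
  | .A i φ => .atom (e (.A i φ))
  | .X i φ => .atom (e (.X i φ))
  | .all x φ => .atom (e (.all x φ))

theorem inst_skeleton {e : Formula n Φ V → ℕ} {σ : ℕ → Formula n Φ V}
    (h : Function.LeftInverse σ e) (φ : Formula n Φ V) : (skeleton e φ).inst σ = φ := by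
  induction φ <;> simp_all [skeleton, PropForm.inst, h _]

section

variable {k q : Prop}

/-! ### Derivability from a set of sentences -/

theorem Pr.mp {φ ψ : Formula n Φ V} (h₁ : Pr k q (imp φ ψ)) (h₂ : Pr k q φ) : Pr k q ψ :=
  Provable.mp h₂ h₁

/-- Iterated implication from the members of a list. -/
def impList (l : List (Formula n Φ V)) (φ : Formula n Φ V) : Formula n Φ V := l.foldr imp φ

@[simp] theorem lng_impList {l : List (Formula n Φ V)} {φ : Formula n Φ V} :
    Lng k q (impList l φ) ↔ (∀ ψ ∈ l, Lng k q ψ) ∧ Lng k q φ := by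
  induction l with
  | nil => simp [impList]
  | cons a l ih =>
    simp only [impList, List.foldr_cons, lng_imp, List.forall_mem_cons] at ih ⊢
    tauto

theorem prims_impList_subset {l : List (Formula n Φ V)} {φ : Formula n Φ V} {L : Set Φ} :
    (impList l φ).prims ⊆ L ↔ (∀ ψ ∈ l, ψ.prims ⊆ L) ∧ φ.prims ⊆ L := by
  induction l with
  | nil => simp [impList]
  | cons a l ih =>
    simp only [impList, List.foldr_cons, prims_imp, List.forall_mem_cons,
      Set.union_subset_iff] at ih ⊢
    tauto

theorem IsBoolean.impList {v : Formula n Φ V → Prop} (hv : IsBoolean v)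
    (l : List (Formula n Φ V)) (φ : Formula n Φ V) :
    v (impList l φ) ↔ ((∀ ψ ∈ l, v ψ) → v φ) := by
  induction l with
  | nil => simp [Awareness.impList]
  | cons a l ih =>
    simp only [Awareness.impList, List.foldr_cons, hv.imp, List.forall_mem_cons] at ih ⊢
    tauto

theorem substVar_impList {l : List (Formula n Φ V)} (hl : ∀ ψ ∈ l, ψ.IsSentence) (x : V)
    (φ θ : Formula n Φ V) : (impList l φ).substVar x θ = impList l (φ.substVar x θ) := by
  induction l with
  | nil => rfl
  | cons a l ih =>
    have ha : x ∉ a.free := by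
      rw [hl a (by simp)]
      exact Set.notMem_empty x
    have := ih fun ψ hψ => hl ψ (by simp [hψ])
    simp only [impList, List.foldr_cons, substVar_imp, substVar_of_notMem_free θ ha] at this ⊢
    rw [this]

theorem substPrim_impList {l : List (Formula n Φ V)} {p : Φ} (hl : ∀ ψ ∈ l, p ∉ ψ.prims)
    (φ θ : Formula n Φ V) : (impList l φ).substPrim p θ = impList l (φ.substPrim p θ) := by
  induction l with
  | nil => rfl
  | cons a l ih =>
    have := ih fun ψ hψ => hl ψ (by simp [hψ])
    simp only [impList, List.foldr_cons, imp, Formula.or, substPrim,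
      substPrim_of_notMem_prims θ (hl a (by simp))] at this ⊢
    rw [this]

theorem substitutable_impList {l : List (Formula n Φ V)} {x : V} {p : Φ} {φ : Formula n Φ V}
    (hl : ∀ ψ ∈ l, p ∉ ψ.prims) (hφ : φ.Substitutable x p) :
    (impList l φ).Substitutable x p := by
  induction l with
  | nil => exact hφ
  | cons a l ih =>
    exact ⟨substitutable_of_notMem_prims x (hl a (by simp)), ih fun ψ hψ => hl ψ (by simp [hψ])⟩

variable (k q) in
/-- Derivability from a set of sentences. -/
def Der (Γ : Set (Formula n Φ V)) (φ : Formula n Φ V) : Prop :=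
  ∃ l : List (Formula n Φ V), (∀ ψ ∈ l, ψ ∈ Γ) ∧ Pr k q (impList l φ)

variable {Γ Δ : Set (Formula n Φ V)} {φ ψ χ : Formula n Φ V}

theorem Der.lng (h : Der k q Γ φ) : Lng k q φ := by
  obtain ⟨l, -, h⟩ := h
  exact (lng_impList.1 h.lng).2

theorem Der.mono (h : Der k q Γ φ) (hΓ : Γ ⊆ Δ) : Der k q Δ φ := by
  obtain ⟨l, hl, h⟩ := h
  exact ⟨l, fun ψ hψ => hΓ (hl ψ hψ), h⟩

theorem Pr.der (h : Pr k q φ) : Der k q Γ φ := ⟨[], by simp, h⟩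

variable (k q) in
/-- A set of sentences from which no contradiction is derivable. -/
def Con (Γ : Set (Formula n Φ V)) : Prop := ∀ φ, Der k q Γ φ → ¬ Der k q Γ (neg φ)

theorem Con.mono (h : Con k q Δ) (hΓ : Γ ⊆ Δ) : Con k q Γ :=
  fun φ h₁ h₂ => h φ (h₁.mono hΓ) (h₂.mono hΓ)

theorem Pr.of_schemesK (h : φ ∈ schemesK n Φ V) (hL : Lng k q φ) : Pr k q φ :=
  .ax ⟨.inl h, hL⟩

theorem Pr.of_schemesAllK (hq : q) (h : φ ∈ schemesAllK n Φ V) (hL : Lng k q φ) : Pr k q φ :=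
  .ax ⟨.inr (.inl ⟨hq, h⟩), hL⟩

/-- The last clause matters because the empty conjunction is the quantified sentence `verum`, which
does not belong to the language without quantifiers. -/
theorem exists_enumeration (hL : Lng k q φ) :
    ∃ l : List Φ, l.Nodup ∧ (∀ p, p ∈ l ↔ p ∈ φ.prims) ∧ (q ∨ l ≠ []) := by
  refine ⟨φ.finite_prims.toFinset.toList, Finset.nodup_toList _, by simp, ?_⟩
  by_cases hq : q
  · exact .inl hq
  · refine .inr ?_
    simpa using (hL.2.2 hq).prims_nonempty.ne_empty

variable [Countable Φ] [Countable V]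

theorem Pr.of_tautology {χ : Formula n Φ V} (hL : Lng k q χ) (h : ∀ v, IsBoolean v → v χ) :
    Pr k q χ := by
  -- Propositional formulas have atoms indexed by `ℕ`; as formulas are countable, each formula that
  -- is not a negation or conjunction can be an atom of its own.
  obtain ⟨e, he⟩ := exists_injective_nat (Formula n Φ V)
  have : Nonempty (Formula n Φ V) := ⟨χ⟩
  refine .ax ⟨.inl (.inl (.inl (.inl (.inl (.inl (.inl ⟨skeleton e χ, Function.invFun e,
    fun b => ?_, (inst_skeleton (Function.leftInverse_invFun he) χ).symm⟩)))))), hL⟩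
  exact h (fun φ => (skeleton e φ).eval b = true)
    ⟨fun φ => by simp [skeleton, PropForm.eval], fun φ ψ => by simp [skeleton, PropForm.eval]⟩

theorem Der.of_mem (h : φ ∈ Γ) (hL : Lng k q φ) : Der k q Γ φ :=
  ⟨[φ], by simpa using h, Pr.of_tautology (by simp [hL]) fun v hv => by simp [hv.impList]⟩

theorem Der.mp (h₁ : Der k q Γ (imp φ ψ)) (h₂ : Der k q Γ φ) : Der k q Γ ψ := by
  obtain ⟨l₁, hl₁, h₁⟩ := h₁
  obtain ⟨l₂, hl₂, h₂⟩ := h₂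
  refine ⟨l₁ ++ l₂, fun χ hχ => (List.mem_append.1 hχ).elim (hl₁ χ) (hl₂ χ), ?_⟩
  have hL₁ := lng_impList.1 h₁.lng
  have hL₂ := lng_impList.1 h₂.lng
  refine ((Pr.of_tautology (χ := imp (impList l₁ (imp φ ψ))
    (imp (impList l₂ φ) (impList (l₁ ++ l₂) ψ))) ?_ fun v hv => ?_).mp h₁).mp h₂
  · have := lng_imp.1 hL₁.2
    simp only [lng_imp, lng_impList, List.mem_append]
    exact ⟨hL₁.imp_right fun _ => this, hL₂,
      fun χ hχ => hχ.elim (hL₁.1 χ) (hL₂.1 χ), this.2⟩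
  · simp only [hv.imp, hv.impList, List.mem_append]
    exact fun h₁ h₂ h => h₁ (fun χ hχ => h χ (.inl hχ)) (h₂ fun χ hχ => h χ (.inr hχ))

/-- Derivability is closed under propositional consequence. -/
theorem Der.consequence {l : List (Formula n Φ V)} (hl : ∀ ψ ∈ l, Der k q Γ ψ)
    (hL : Lng k q χ) (h : ∀ v, IsBoolean v → (∀ ψ ∈ l, v ψ) → v χ) : Der k q Γ χ := by
  induction l generalizing χ with
  | nil => exact (Pr.of_tautology hL fun v hv => h v hv (by simp)).der
  | cons a l ih =>
    have ha := hl a (by simp)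
    refine Der.mp (ih (fun ψ hψ => hl ψ (by simp [hψ])) (lng_imp.2 ⟨ha.lng, hL⟩)
      fun v hv hv' => ?_) ha
    rw [hv.imp]
    exact fun hva => h v hv (by simpa using ⟨hva, hv'⟩)

theorem Der.taut₁ (h₁ : Der k q Γ φ) (hL : Lng k q χ)
    (h : ∀ v, IsBoolean v → v φ → v χ) : Der k q Γ χ :=
  Der.consequence (l := [φ]) (by simpa using h₁) hL (by simpa using h)

theorem Der.taut₂ (h₁ : Der k q Γ φ) (h₂ : Der k q Γ ψ) (hL : Lng k q χ)
    (h : ∀ v, IsBoolean v → v φ → v ψ → v χ) : Der k q Γ χ :=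
  Der.consequence (l := [φ, ψ]) (by simpa using ⟨h₁, h₂⟩) hL (by simpa using h)

/-- The deduction theorem. -/
theorem Der.deduction (h : Der k q (insert φ Γ) ψ) (hL : Lng k q φ) :
    Der k q Γ (imp φ ψ) := by
  classical
  obtain ⟨l, hl, h⟩ := h
  have hLl := lng_impList.1 h.lng
  refine ⟨l.filter (· ≠ φ), fun χ hχ => ?_, ?_⟩
  · simp only [ne_eq, decide_not, List.mem_filter, Bool.not_eq_eq_eq_not, Bool.not_true,
      decide_eq_false_iff_not] at hχ
    exact (hl χ hχ.1).resolve_left hχ.2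
  · refine (Pr.of_tautology (χ := imp (impList l ψ) _) ?_ fun v hv => ?_).mp h
    · simp only [lng_imp, lng_impList]
      exact ⟨hLl, fun χ hχ => hLl.1 χ (List.mem_of_mem_filter hχ), hL, hLl.2⟩
    · simp only [hv.imp, hv.impList, List.mem_filter, decide_eq_true_eq]
      intro h₁ h₂ h₃
      refine h₁ fun χ hχ => ?_
      by_cases hχφ : χ = φ
      · rwa [hχφ]
      · exact h₂ χ ⟨hχ, hχφ⟩

theorem Der.of_impList {l : List (Formula n Φ V)} (h : Der k q Γ (impList l φ))
    (hl : ∀ ψ ∈ l, Der k q Γ ψ) : Der k q Γ φ :=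
  Der.consequence (l := impList l φ :: l) (by simpa using ⟨h, hl⟩) (lng_impList.1 h.lng).2
    fun v hv h => by
      rw [List.forall_mem_cons, hv.impList] at h
      exact h.1 h.2

theorem Der.to_impList {l : List (Formula n Φ V)} (hL : ∀ ψ ∈ l, Lng k q ψ)
    (h : Der k q (Γ ∪ {ψ | ψ ∈ l}) φ) : Der k q Γ (impList l φ) := by
  induction l generalizing Γ with
  | nil => exact h.mono (by simp)
  | cons a l ih =>
    refine Der.deduction (ih (fun ψ hψ => hL ψ (by simp [hψ])) ?_) (hL a (by simp))
    refine h.mono ?_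
    rintro ψ (hψ | hψ)
    · exact .inl (.inr hψ)
    · rcases List.mem_cons.1 hψ with rfl | hψ
      · exact .inl (.inl rfl)
      · exact .inr hψ

theorem der_neg_of_not_con (h : ¬ Con k q (insert φ Γ)) (hL : Lng k q φ) :
    Der k q Γ (neg φ) := by
  simp only [Con, not_forall, not_not] at h
  obtain ⟨ψ, h₁, h₂⟩ := h
  exact Der.taut₂ (h₁.deduction hL) (h₂.deduction hL) hL fun v hv h₁ h₂ => by
    rw [hv.imp] at h₁ h₂
    rw [hv.neg] at h₂ ⊢
    tauto

theorem der_of_not_con_neg (h : ¬ Con k q (insert (neg φ) Γ)) (hL : Lng k q φ) :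
    Der k q Γ φ :=
  Der.taut₁ (der_neg_of_not_con h hL) hL fun v hv h => by
    rw [hv.neg, hv.neg] at h
    tauto

theorem Con.insert_or (h : Con k q Γ) (hL : Lng k q φ) :
    Con k q (insert φ Γ) ∨ Con k q (insert (neg φ) Γ) := by
  by_contra! h'
  exact h _ (der_of_not_con_neg h'.2 hL) (der_neg_of_not_con h'.1 hL)

/-! ### Modal reasoning -/

variable {i : Fin n}

theorem Der.K_mp (h₁ : Der k q Γ (K i (imp φ ψ))) (h₂ : Der k q Γ (K i φ)) :
    Der k q Γ (K i ψ) := by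
  have hL : Lng k q φ ∧ Lng k q ψ := lng_imp.1 (lng_K.1 h₁.lng)
  have hax : Pr k q (imp (and (K i φ) (K i (imp φ ψ))) (K i ψ)) :=
    .of_schemesK (.inl (.inl (.inl (.inl (.inr ⟨i, φ, ψ, rfl⟩))))) (by simp [hL])
  refine (hax.der).mp (Der.taut₂ h₂ h₁ (by simp [hL]) fun v hv h₁ h₂ => ?_)
  rw [hv.and]
  exact ⟨h₁, h₂⟩

theorem Der.Astar_of_K (h : Der k q Γ (K i φ)) : Der k q Γ (Astar i φ) := by
  have hL : Lng k q φ := h.lng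
  exact Der.mp (Pr.der (.of_schemesK (.inl (.inl (.inl (.inr ⟨i, φ, rfl⟩)))) (by simp [hL]))) h

theorem Der.of_K (h : Der k q Γ (K i φ)) : Der k q Γ φ := by
  have hL : Lng k q φ := h.lng
  exact Der.mp (Pr.der (.of_schemesK (.inl (.inl (.inr ⟨i, φ, rfl⟩))) (by simp [hL]))) h

theorem Der.K_K (h : Der k q Γ (K i φ)) : Der k q Γ (K i (K i φ)) := by
  have hL : Lng k q φ := h.lng
  exact Der.mp (Pr.der (.of_schemesK (.inl (.inr ⟨i, φ, rfl⟩)) (by simp [hL]))) h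

theorem Der.K_neg_K (h₁ : Der k q Γ (neg (K i φ))) (h₂ : Der k q Γ (Astar i φ)) :
    Der k q Γ (K i (neg (K i φ))) := by
  have hL : Lng k q φ := h₁.lng
  have hax : Pr k q (imp (and (neg (K i φ)) (Astar i φ)) (K i (neg (K i φ)))) :=
    .of_schemesK (.inr ⟨i, φ, rfl⟩) (by simp [hL])
  refine (hax.der).mp (Der.taut₂ h₁ h₂ (by simp [hL]) fun v hv h₁ h₂ => ?_)
  rw [hv.and]
  exact ⟨h₁, h₂⟩

theorem Der.gen (h : Pr k q φ) (h' : Der k q Γ (Astar i φ)) : Der k q Γ (K i φ) :=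
  Der.mp (Pr.der (Provable.genStar i h)) h'

theorem Der.K_of_impList {l : List (Formula n Φ V)} (h : Der k q Γ (K i (impList l φ)))
    (hl : ∀ ψ ∈ l, Der k q Γ (K i ψ)) : Der k q Γ (K i φ) := by
  induction l with
  | nil => exact h
  | cons a l ih => exact ih (Der.K_mp h (hl a (by simp))) fun ψ hψ => hl ψ (by simp [hψ])

/-! ### Quantifiers -/

theorem Der.inst_all {x : V} {θ : Formula n Φ V} (h : Der k q Γ (all x φ))
    (hθ : θ ∈ Rng n Φ V k) : Der k q Γ (φ.substVar x θ) :=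
  have hL := h.lng
  Der.mp (Pr.der (.of_schemesAllK (lng_all.1 hL).1
    (.inl (.inl (.inl (.inl (.inr ⟨x, φ, θ, hθ.1, rfl⟩)))))
    (lng_imp.2 ⟨hL, hL.substVar hθ⟩))) h

theorem Der.all_mp {x : V} (h₁ : Der k q Γ (all x (imp φ ψ))) (h₂ : Der k q Γ (all x φ))
    (hL : Lng k q (all x ψ)) : Der k q Γ (all x ψ) :=
  Der.mp (Der.mp (Pr.der (.of_schemesAllK (lng_all.1 hL).1
    (.inl (.inl (.inl (.inr ⟨x, φ, ψ, rfl⟩)))) (by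
      simp only [lng_imp]
      exact ⟨h₁.lng, h₂.lng, hL⟩))) h₁) h₂

theorem Der.all_of_sentence (hq : q) (h : Der k q Γ φ) (x : V) : Der k q Γ (all x φ) := by
  have hf : φ.free = ∅ := h.lng.1
  refine Der.mp (Pr.der (.of_schemesAllK hq (.inl (.inl (.inr ⟨x, φ, by simp [hf], rfl⟩))) ?_)) h
  exact lng_imp.2 ⟨h.lng, lng_all.2 ⟨hq, by simp [hf], h.lng.2.1⟩⟩

/-- The premises are sentences, so N_∀ prefixes them with `∀x` and K_∀ discharges them one at a
time. -/
theorem Der.all_of_impList (hq : q) {l : List (Formula n Φ V)} {x : V}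
    (hl : ∀ ψ ∈ l, Der k q Γ ψ) (h : Der k q Γ (all x (impList l φ))) :
    Der k q Γ (all x φ) := by
  induction l with
  | nil => exact h
  | cons a l ih =>
    have ha := hl a (by simp)
    refine ih (fun ψ hψ => hl ψ (by simp [hψ])) (Der.all_mp h (ha.all_of_sentence hq x) ?_)
    have hL := lng_all.1 h.lng
    rw [lng_all]
    exact ⟨hq, (Set.subset_union_right.trans hL.2.1), fun hk => (hL.2.2 hk).2⟩

/-- Generalization on a primitive proposition that does not occur in the assumptions. -/
theorem Der.generalize (hq : q) {x : V} {p : Φ} (hΓ : ∀ ψ ∈ Γ, p ∉ ψ.prims)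
    (hx : φ.Substitutable x p) (h : Der k q Γ φ) :
    Der k q Γ (all x (φ.substPrim p (var x))) := by
  obtain ⟨l, hl, h⟩ := h
  have hp : ∀ ψ ∈ l, p ∉ ψ.prims := fun ψ hψ => hΓ ψ (hl ψ hψ)
  have hg : Pr k q (all x ((impList l φ).substPrim p (var x))) :=
    Provable.genAll hq x p (substitutable_impList hp hx) h
  rw [substPrim_impList hp] at hg
  exact hg.der.all_of_impList hq fun ψ hψ => .of_mem (hl ψ hψ) ((lng_impList.1 h.lng).1 ψ hψ)

/-- The fresh proposition `p` plays the part of an eigenvariable. -/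
theorem Der.all_of_instance (hq : q) {x : V} {p : Φ} (hΓ : ∀ ψ ∈ Γ, p ∉ ψ.prims)
    (hp : p ∉ φ.prims) (h : Der k q Γ (φ.substVar x (prim p))) : Der k q Γ (all x φ) := by
  have := h.generalize hq hΓ (substitutable_substVar_prim x hp)
  rwa [substPrim_substVar_prim x hp] at this

theorem Pr.verum [Nonempty Φ] (hq : q) (x : V) : Pr k q (verum x : Formula n Φ V) := by
  obtain ⟨p⟩ := ‹Nonempty Φ›
  have h : Pr k q (Formula.or (prim p) (neg (prim p)) : Formula n Φ V) :=
    .of_tautology (by simp) fun v hv => by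
      rw [hv.or, hv.neg]
      exact em _
  have := Provable.genAll hq x p (by simp [Formula.or, Substitutable]) h
  rw [Pr, Formula.verum]
  simpa [Formula.or, substPrim] using this

/-! ### Conjunctions and awareness -/

theorem Der.of_conj {x : V} {l : List (Formula n Φ V)} (hl : ∀ ψ ∈ l, Lng k q ψ)
    (h : Der k q Γ (conj x l)) : ∀ ψ ∈ l, Der k q Γ ψ := by
  induction l using conj.induct with
  | case1 => simp
  | case2 a => simpa [conj] using h
  | case3 a b l ih =>
    rw [conj] at h
    have hL := lng_and.1 h.lng
    rw [List.forall_mem_cons] at hl ⊢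
    exact ⟨h.taut₁ hL.1 fun v hv h => ((hv.and _ _).1 h).1,
      ih hl.2 (h.taut₁ hL.2 fun v hv h => ((hv.and _ _).1 h).2)⟩

theorem Der.conj [Nonempty Φ] {x : V} {l : List (Formula n Φ V)} (hl : ∀ ψ ∈ l, Der k q Γ ψ)
    (hne : q ∨ l ≠ []) : Der k q Γ (conj x l) := by
  induction l using conj.induct with
  | case1 => exact (Pr.verum (by simpa using hne) x).der
  | case2 a => simpa [Formula.conj] using hl
  | case3 a b l ih =>
    rw [List.forall_mem_cons] at hl
    have h := ih hl.2 (by simp)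
    exact Der.taut₂ hl.1 h (lng_and.2 ⟨hl.1.lng, h.lng⟩) fun v hv h₁ h₂ => (hv.and _ _).2 ⟨h₁, h₂⟩

/-- `Astar i φ` is derivable iff `Astar i p` is, for every primitive proposition `p` of `φ`. -/
theorem der_Astar_iff [Nonempty Φ] [Nonempty V] (hL : Lng k q φ) :
    Der k q Γ (Astar i φ) ↔ ∀ p ∈ φ.prims, Der k q Γ (Astar i (prim p)) := by
  obtain ⟨x⟩ := ‹Nonempty V›
  obtain ⟨l, hnd, hl, hne⟩ := exists_enumeration hL
  have hLl : ∀ ψ ∈ l.map (fun p => Astar i (prim p : Formula n Φ V)), Lng k q ψ := by simp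
  -- Derivability from the set of all formulas serves only to read off that the conjunction belongs
  -- to the language.
  have hLc : Lng k q (conj x (l.map fun p => Astar i (prim p : Formula n Φ V))) :=
    (Der.conj (Γ := Set.univ) (fun ψ hψ => .of_mem trivial (hLl ψ hψ)) (by simpa using hne)).lng
  have hax : Pr k q (iff (Astar i φ) (conj x (l.map fun p => Astar i (prim p)))) :=
    .of_schemesK (.inl (.inl (.inl (.inl (.inl (.inr ⟨i, φ, l, x, hnd, hl, rfl⟩))))))
      (lng_iff.2 ⟨by simpa using hL, hLc⟩)
  constructor
  · intro h p hp
    refine Der.of_conj (x := x) hLl ?_ _ (List.mem_map_of_mem ((hl p).2 hp))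
    exact Der.taut₂ hax.der h hLc fun v hv h₁ h₂ => ((hv.iff _ _).1 h₁).1 h₂
  · intro h
    refine Der.taut₂ hax.der (Der.conj (x := x) ?_ (by simpa using hne)) (by simpa using hL)
      fun v hv h₁ h₂ => ((hv.iff _ _).1 h₁).2 h₂
    simpa [hl] using h

/-- `A i φ` is derivable iff `A i p` is, for every primitive proposition `p` of `φ`. -/
theorem der_A_iff [Nonempty Φ] [Nonempty V] (hk : ¬ k) (hL : Lng k q φ) :
    Der k q Γ (A i φ) ↔ ∀ p ∈ φ.prims, Der k q Γ (A i (prim p)) := by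
  obtain ⟨x⟩ := ‹Nonempty V›
  obtain ⟨l, hnd, hl, hne⟩ := exists_enumeration hL
  have hLl : ∀ ψ ∈ l.map (fun p => A i (prim p : Formula n Φ V)), Lng k q ψ := by
    simp [lng_A, hk]
  have hLc : Lng k q (conj x (l.map fun p => A i (prim p : Formula n Φ V))) :=
    (Der.conj (Γ := Set.univ) (fun ψ hψ => .of_mem trivial (hLl ψ hψ)) (by simpa using hne)).lng
  have hax : Pr k q (iff (A i φ) (conj x (l.map fun p => A i (prim p)))) :=
    .ax ⟨.inr (.inr ⟨hk, .inl (.inl ⟨i, φ, l, x, hnd, hl, rfl⟩)⟩),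
      lng_iff.2 ⟨lng_A.2 ⟨hk, hL⟩, hLc⟩⟩
  constructor
  · intro h p hp
    refine Der.of_conj (x := x) hLl ?_ _ (List.mem_map_of_mem ((hl p).2 hp))
    exact Der.taut₂ hax.der h hLc fun v hv h₁ h₂ => ((hv.iff _ _).1 h₁).1 h₂
  · intro h
    refine Der.taut₂ hax.der (Der.conj (x := x) ?_ (by simpa using hne)) (lng_A.2 ⟨hk, hL⟩)
      fun v hv h₁ h₂ => ((hv.iff _ _).1 h₁).2 h₂
    simpa [hl] using h

theorem Der.K_A (hk : ¬ k) (h : Der k q Γ (A i φ)) : Der k q Γ (K i (A i φ)) :=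
  Der.mp (Pr.der (.ax ⟨.inr (.inr ⟨hk, .inl (.inr ⟨i, φ, rfl⟩)⟩),
    lng_imp.2 ⟨h.lng, lng_K.2 h.lng⟩⟩)) h

theorem der_X_iff (hk : ¬ k) (hL : Lng k q φ) :
    Der k q Γ (X i φ) ↔ Der k q Γ (K i φ) ∧ Der k q Γ (A i φ) := by
  have hA : Lng k q (A i φ) := lng_A.2 ⟨hk, hL⟩
  have hX : Lng k q (X i φ) := lng_X.2 ⟨hk, hL⟩
  have hax : Pr k q (iff (X i φ) (and (K i φ) (A i φ))) :=
    .ax ⟨.inr (.inr ⟨hk, .inr ⟨i, φ, rfl⟩⟩), by simp [hA, hX, hL]⟩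
  refine ⟨fun h => ?_, fun h => ?_⟩
  · have h' : Der k q Γ (and (K i φ) (A i φ)) := Der.taut₂ hax.der h (by simp [hA, hL])
      fun v hv h₁ h₂ => ((hv.iff _ _).1 h₁).1 h₂
    exact ⟨h'.taut₁ hL fun v hv h => ((hv.and _ _).1 h).1,
      h'.taut₁ hA fun v hv h => ((hv.and _ _).1 h).2⟩
  · refine Der.consequence (l := [_, _, _]) (by simpa using ⟨hax.der, h.1, h.2⟩) hX
      fun v hv h => ?_
    simp only [List.mem_cons, List.not_mem_nil, or_false, forall_eq_or_imp, forall_eq, hv.iff,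
      hv.and] at h
    tauto

/-! ### The Barcan formula -/

/-- What is possibly known of everything that the agent is aware of is true of it. -/
theorem Der.barcan [Nonempty V] {y : V} {p : Φ} (hL : Lng k q (all y φ))
    (h₁ : Der k q Γ (neg (K i (neg (all y (imp (Astar i (var y)) (K i φ)))))))
    (h₂ : Der k q Γ (Astar i (all y φ))) :
    Der k q Γ (imp (Astar i (prim p)) (φ.substVar y (prim p))) := by
  have : Nonempty Φ := ⟨p⟩
  set Ψ : Formula n Φ V := all y (imp (Astar i (var y)) (K i φ)) with hΨ
  have hLΨ : Lng k q Ψ := h₁.lng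
  have hLp := hL.substVar (prim_mem_rng (n := n) (V := V) p)
  set χ := φ.substVar y (prim p) with hχ
  have hinst : Pr k q (imp Ψ (imp (Astar i (prim p)) (K i χ))) := by
    refine .of_schemesAllK (lng_all.1 hL).1
      (.inl (.inl (.inl (.inl (.inr ⟨y, imp (Astar i (var y)) (K i φ), prim p, trivial, ?_⟩))))) (by simp [hLΨ, hLp])
    simp only [substVar_imp, substVar_Astar, substVar_var_self, substVar_K, hΨ, hχ]
  have hcontra : Pr k q (imp (Astar i (prim p)) (imp (neg (K i χ)) (neg Ψ))) := by
    refine Pr.mp (.of_tautology (by simp [hLΨ, hLp]) fun v hv => ?_) hinst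
    simp only [hv.imp, hv.neg]
    tauto
  have hprims : ∀ r ∈ χ.prims, r ∈ φ.prims ∨ r = p := fun r hr => by
    exact prims_substVar_subset y φ (prim p) hr
  -- An S5 argument from T, 4 and 5^*, without the axiom Barcan^*. Given `¬χ`, T yields `¬K_i χ` and
  -- 5^* yields `K_i ¬K_i χ`; 4 yields `K_i A_i^* p`. The known contrapositive then gives `K_i ¬Ψ`,
  -- against `h₁`. AGPP^* provides the star-awareness that 5^* and Gen^* demand.
  refine Der.deduction (by_contra fun hnot => ?_) (by simp)
  set Δ := insert (Astar i (prim p)) Γ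
  have hcon : Con k q (insert (neg χ) Δ) := by
    by_contra h
    exact hnot (der_of_not_con_neg h hLp)
  have hAp : Der k q (insert (neg χ) Δ) (Astar i (prim p)) :=
    .of_mem (.inr (.inl rfl)) (by simp)
  have hAφ : ∀ r ∈ φ.prims, Der k q (insert (neg χ) Δ) (Astar i (prim r)) := by
    refine (der_Astar_iff hL).1 (h₂.mono fun ψ hψ => .inr (.inr hψ))
  have hAχ : Der k q (insert (neg χ) Δ) (Astar i χ) := by
    rw [der_Astar_iff hLp]
    intro r hr
    rcases hprims r hr with h | rfl
    · exact hAφ r h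
    · exact hAp
  have hnχ : Der k q (insert (neg χ) Δ) (neg χ) := .of_mem (.inl rfl) (by simpa using hLp)
  have hnK : Der k q (insert (neg χ) Δ) (neg (K i χ)) := by
    by_contra h
    have h' : ¬ Con k q (insert (K i χ) (insert (neg χ) Δ)) := fun hc =>
      hc χ (Der.of_mem (.inl rfl) (by simpa using hLp)).of_K (hnχ.mono (Set.subset_insert _ _))
    exact h (der_neg_of_not_con h' (by simpa using hLp))
  have hK := hnK.K_neg_K hAχ
  have hcK : Der k q (insert (neg χ) Δ)
      (K i (imp (Astar i (prim p)) (imp (neg (K i χ)) (neg Ψ)))) := by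
    refine Der.gen hcontra ((der_Astar_iff (by simp [hLΨ, hLp])).2 fun r hr => ?_)
    simp only [prims_imp, prims_Astar, prims, hΨ, Set.mem_union, Set.mem_singleton_iff] at hr
    rcases hr with rfl | hr | hr | hr
    · exact hAp
    · rcases hprims r hr with h | rfl
      · exact hAφ r h
      · exact hAp
    · simp at hr
    · exact hAφ r hr
  exact hcon _ ((hcK.K_mp hAp.K_K).K_mp hK) (h₁.mono fun ψ hψ => .inr (.inr hψ))

end

end Awareness

namespace Awareness

open Formula

variable {n : ℕ} {Φ V : Type u} {k q : Prop}

/-! ### Worlds of the canonical structure -/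

/-- A maximal consistent set of sentences over the primitive propositions in `L`, with a
quantifier-free counterexample to every universal sentence that it refutes. Infinitely many
primitive propositions are left over. -/
structure IsWorld (k q : Prop) (L : Set Φ) (Γ : Set (Formula n Φ V)) : Prop where
  nonempty : L.Nonempty
  infinite_compl : Lᶜ.Infinite
  lng : ∀ {φ}, φ ∈ Γ → Lng k q φ
  prims_subset : ∀ {φ}, φ ∈ Γ → φ.prims ⊆ L
  mem_or : ∀ {φ}, Lng k q φ → φ.prims ⊆ L → φ ∈ Γ ∨ neg φ ∈ Γ
  con : Con k q Γ
  counterexample : ∀ {x φ}, neg (all x φ) ∈ Γ →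
    ∃ θ ∈ Rng n Φ V k, θ.prims ⊆ L ∧ neg (φ.substVar x θ) ∈ Γ

namespace IsWorld

variable [Countable Φ] [Countable V] {L : Set Φ} {Γ : Set (Formula n Φ V)}
  {φ ψ : Formula n Φ V} {i : Fin n}

theorem der (h : IsWorld k q L Γ) (hφ : φ ∈ Γ) : Der k q Γ φ := .of_mem hφ (h.lng hφ)

theorem mem_of_der (h : IsWorld k q L Γ) (hφ : Der k q Γ φ) (hL : φ.prims ⊆ L) : φ ∈ Γ :=
  (h.mem_or hφ.lng hL).resolve_right fun hn => h.con φ hφ (h.der hn)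

theorem neg_mem (h : IsWorld k q L Γ) (hφ : Lng k q φ) (hL : φ.prims ⊆ L) :
    neg φ ∈ Γ ↔ φ ∉ Γ :=
  ⟨fun h₁ h₂ => h.con φ (h.der h₂) (h.der h₁), fun h₁ => (h.mem_or hφ hL).resolve_left h₁⟩

theorem and_mem (h : IsWorld k q L Γ) : and φ ψ ∈ Γ ↔ φ ∈ Γ ∧ ψ ∈ Γ := by
  constructor
  · intro hm
    have hL := lng_and.1 (h.lng hm)
    have hs := Set.union_subset_iff.1 (h.prims_subset hm)
    exact ⟨h.mem_of_der ((h.der hm).taut₁ hL.1 fun v hv h => ((hv.and _ _).1 h).1) hs.1,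
      h.mem_of_der ((h.der hm).taut₁ hL.2 fun v hv h => ((hv.and _ _).1 h).2) hs.2⟩
  · rintro ⟨h₁, h₂⟩
    exact h.mem_of_der (Der.taut₂ (h.der h₁) (h.der h₂) (lng_and.2 ⟨h.lng h₁, h.lng h₂⟩)
      fun v hv h₁ h₂ => (hv.and _ _).2 ⟨h₁, h₂⟩)
      (Set.union_subset (h.prims_subset h₁) (h.prims_subset h₂))

theorem all_mem (h : IsWorld k q L Γ) {x : V} (hφ : Lng k q (all x φ)) (hL : φ.prims ⊆ L) :
    all x φ ∈ Γ ↔ ∀ θ ∈ Rng n Φ V k, θ.prims ⊆ L → φ.substVar x θ ∈ Γ := by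
  constructor
  · intro hm θ hθ hθL
    exact h.mem_of_der ((h.der hm).inst_all hθ)
      ((prims_substVar_subset x φ θ).trans (Set.union_subset hL hθL))
  · intro hall
    refine (h.mem_or hφ hL).resolve_right fun hn => ?_
    obtain ⟨θ, hθ, hθL, hm⟩ := h.counterexample hn
    exact h.con _ (h.der (hall θ hθ hθL)) (h.der hm)

theorem of_K_mem (h : IsWorld k q L Γ) (hm : K i φ ∈ Γ) : φ ∈ Γ :=
  h.mem_of_der (h.der hm).of_K (h.prims_subset hm :)

theorem K_K_mem (h : IsWorld k q L Γ) (hm : K i φ ∈ Γ) : K i (K i φ) ∈ Γ :=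
  h.mem_of_der (h.der hm).K_K (h.prims_subset hm :)

theorem Astar_mem_of_K_mem (h : IsWorld k q L Γ) (hm : K i φ ∈ Γ) : Astar i φ ∈ Γ :=
  h.mem_of_der (h.der hm).Astar_of_K (by rw [prims_Astar]; exact (h.prims_subset hm :))

theorem Astar_mem [Nonempty V] (h : IsWorld k q L Γ) (hφ : Lng k q φ) :
    Astar i φ ∈ Γ ↔ ∀ p ∈ φ.prims, Astar i (prim p) ∈ Γ := by
  have : Nonempty Φ := h.nonempty.to_type
  constructor
  · intro hm p hp
    refine h.mem_of_der ((der_Astar_iff hφ).1 (h.der hm) p hp) ?_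
    have := h.prims_subset hm
    simpa [prims] using this (by simpa using hp)
  · intro hall
    refine h.mem_of_der ((der_Astar_iff hφ).2 fun p hp => h.der (hall p hp)) ?_
    intro p hp
    exact h.prims_subset (hall p (by simpa using hp)) (by simp [prims])

theorem K_neg_K_mem (h : IsWorld k q L Γ) (hm : neg (K i φ) ∈ Γ) (hA : Astar i φ ∈ Γ) :
    K i (neg (K i φ)) ∈ Γ :=
  h.mem_of_der ((h.der hm).K_neg_K (h.der hA)) (h.prims_subset hm :)

theorem A_mem [Nonempty V] (h : IsWorld k q L Γ) (hA : Lng k q (A i φ)) :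
    A i φ ∈ Γ ↔ ∀ p ∈ φ.prims, A i (prim p) ∈ Γ := by
  have : Nonempty Φ := h.nonempty.to_type
  obtain ⟨hk, hφ⟩ := lng_A.1 hA
  constructor
  · intro hm p hp
    refine h.mem_of_der ((der_A_iff hk hφ).1 (h.der hm) p hp) ?_
    simpa [prims] using h.prims_subset hm hp
  · intro hall
    refine h.mem_of_der ((der_A_iff hk hφ).2 fun p hp => h.der (hall p hp)) ?_
    exact fun p hp => h.prims_subset (hall p hp) rfl

theorem K_A_mem (h : IsWorld k q L Γ) (hm : A i φ ∈ Γ) : K i (A i φ) ∈ Γ :=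
  h.mem_of_der ((h.der hm).K_A (lng_A.1 (h.lng hm)).1) (h.prims_subset hm :)

theorem X_mem (h : IsWorld k q L Γ) (hX : Lng k q (X i φ)) (hL : φ.prims ⊆ L) :
    X i φ ∈ Γ ↔ K i φ ∈ Γ ∧ A i φ ∈ Γ := by
  obtain ⟨hk, hφ⟩ := lng_X.1 hX
  refine ⟨fun hm => ?_, fun hm => ?_⟩
  · have := (der_X_iff hk hφ).1 (h.der hm)
    exact ⟨h.mem_of_der this.1 hL, h.mem_of_der this.2 hL⟩
  · exact h.mem_of_der ((der_X_iff hk hφ).2 ⟨h.der hm.1, h.der hm.2⟩) hL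

/-- Worlds exist: the finite sets of a family that allows one to decide sentences and to add
counterexamples extend to worlds that are directed unions of members of the family. -/
theorem exists_of_family {ok : Finset (Formula n Φ V) → Prop} (hne : L.Nonempty)
    (hco : Lᶜ.Infinite) (hcon : ∀ F, ok F → Con k q (F : Set (Formula n Φ V)))
    (hlng : ∀ F, ok F → ∀ φ ∈ F, Lng k q φ ∧ φ.prims ⊆ L)
    (hdecide : ∀ F φ, ok F → Lng k q φ → φ.prims ⊆ L →
      ∃ F', F ⊆ F' ∧ ok F' ∧ (φ ∈ F' ∨ neg φ ∈ F'))
    (hcounter : ∀ F x φ, ok F → neg (all x φ) ∈ F →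
      ∃ F', F ⊆ F' ∧ ok F' ∧ ∃ θ ∈ Rng n Φ V k, θ.prims ⊆ L ∧ neg (φ.substVar x θ) ∈ F')
    {F₀ : Finset (Formula n Φ V)} (h₀ : ok F₀) :
    ∃ Γ, IsWorld k q L Γ ∧ (F₀ : Set (Formula n Φ V)) ⊆ Γ ∧
      ∀ F : Finset (Formula n Φ V), (F : Set (Formula n Φ V)) ⊆ Γ →
        ∃ F', F ⊆ F' ∧ ok F' ∧ (F' : Set (Formula n Φ V)) ⊆ Γ := by
  classical
  -- A Rasiowa–Sikorski argument: deciding a sentence and supplying a counterexample are cofinal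
  -- requirements on admissible finite sets. There are countably many, so an ideal meets them all,
  -- and its union is the world.
  let D₁ : Formula n Φ V → Order.Cofinal {F // ok F} := fun φ =>
    { carrier := {F | Lng k q φ → φ.prims ⊆ L → φ ∈ F.1 ∨ neg φ ∈ F.1}
      isCofinal := by
        rintro ⟨F, hF⟩
        by_cases h : Lng k q φ ∧ φ.prims ⊆ L
        · obtain ⟨F', hFF', hF', hφ⟩ := hdecide F φ hF h.1 h.2
          exact ⟨⟨F', hF'⟩, fun _ _ => hφ, hFF'⟩
        · exact ⟨⟨F, hF⟩, fun h₁ h₂ => (h ⟨h₁, h₂⟩).elim, le_rfl⟩ }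
  let D₂ : V × Formula n Φ V → Order.Cofinal {F // ok F} := fun xφ =>
    { carrier := {F | Lng k q (all xφ.1 xφ.2) → xφ.2.prims ⊆ L → all xφ.1 xφ.2 ∈ F.1 ∨
        ∃ θ ∈ Rng n Φ V k, θ.prims ⊆ L ∧ neg (xφ.2.substVar xφ.1 θ) ∈ F.1}
      isCofinal := by
        rintro ⟨F, hF⟩
        by_cases h : Lng k q (all xφ.1 xφ.2) ∧ xφ.2.prims ⊆ L
        · obtain ⟨F', hFF', hF', hφ | hφ⟩ := hdecide F (all xφ.1 xφ.2) hF h.1 h.2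
          · exact ⟨⟨F', hF'⟩, fun _ _ => .inl hφ, hFF'⟩
          · obtain ⟨F'', hFF'', hF'', hθ⟩ := hcounter F' _ _ hF' hφ
            exact ⟨⟨F'', hF''⟩, fun _ _ => .inr hθ, hFF'.trans hFF''⟩
        · exact ⟨⟨F, hF⟩, fun h₁ h₂ => (h ⟨h₁, h₂⟩).elim, le_rfl⟩ }
  have : Encodable (Formula n Φ V ⊕ (V × Formula n Φ V)) := Encodable.ofCountable _
  let I := Order.idealOfCofinals ⟨F₀, h₀⟩ (Sum.elim D₁ D₂)
  let Γ : Set (Formula n Φ V) := {φ | ∃ F ∈ I, φ ∈ F.1}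
  -- By directedness a finite part of the union lies in one member of the ideal, so an inconsistency
  -- would already occur there.
  have hfin : ∀ F : Finset (Formula n Φ V), (F : Set (Formula n Φ V)) ⊆ Γ →
      ∃ F' ∈ I, F ⊆ F'.1 := by
    intro F
    induction F using Finset.induction_on with
    | empty => exact fun _ => ⟨⟨F₀, h₀⟩, Order.mem_idealOfCofinals _ _, by simp⟩
    | insert a F _ ih =>
      intro hF
      rw [Finset.coe_insert, Set.insert_subset_iff] at hF
      obtain ⟨F₁, hF₁, ha⟩ := hF.1
      obtain ⟨F₂, hF₂, hs⟩ := ih hF.2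
      obtain ⟨F₃, hF₃, h₁, h₂⟩ := I.directed F₁ hF₁ F₂ hF₂
      exact ⟨F₃, hF₃, Finset.insert_subset (h₁ ha) (hs.trans h₂)⟩
  have hΓ : ∀ F ∈ I, (F.1 : Set (Formula n Φ V)) ⊆ Γ := fun F hF φ hφ => ⟨F, hF, hφ⟩
  have hderiv : Con k q Γ := by
    rintro φ ⟨l₁, hl₁, h₁⟩ ⟨l₂, hl₂, h₂⟩
    obtain ⟨F, hF, hs⟩ := hfin (l₁ ++ l₂).toFinset (by
      intro ψ hψ
      simp only [List.coe_toFinset, Set.mem_ofPred_eq, List.mem_append] at hψ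
      exact hψ.elim (hl₁ ψ) (hl₂ ψ))
    exact hcon F.1 F.2 φ ⟨l₁, fun ψ hψ => hs (by simp [hψ]), h₁⟩
      ⟨l₂, fun ψ hψ => hs (by simp [hψ]), h₂⟩
  have hmem_or : ∀ {φ}, Lng k q φ → φ.prims ⊆ L → φ ∈ Γ ∨ neg φ ∈ Γ := by
    intro φ hφ hL
    obtain ⟨F, hF, hI⟩ := Order.cofinal_meets_idealOfCofinals ⟨F₀, h₀⟩ (Sum.elim D₁ D₂) (.inl φ)
    exact (hF hφ hL).imp (fun h => ⟨F, hI, h⟩) fun h => ⟨F, hI, h⟩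
  have hlngΓ : ∀ {φ}, φ ∈ Γ → Lng k q φ ∧ φ.prims ⊆ L := by
    rintro φ ⟨F, -, hφ⟩
    exact hlng F.1 F.2 φ hφ
  refine ⟨Γ, ⟨hne, hco, fun h => (hlngΓ h).1, fun h => (hlngΓ h).2, hmem_or, hderiv, ?_⟩,
    hΓ ⟨F₀, h₀⟩ (Order.mem_idealOfCofinals _ _), fun F hF => ?_⟩
  · intro x φ hm
    have hL := hlngΓ hm
    obtain ⟨F, hF, hI⟩ :=
      Order.cofinal_meets_idealOfCofinals ⟨F₀, h₀⟩ (Sum.elim D₁ D₂) (.inr (x, φ))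
    rcases hF hL.1 hL.2 with h | ⟨θ, hθ, hθL, h⟩
    · exact (hderiv (all x φ) (.of_mem ⟨F, hI, h⟩ hL.1) (.of_mem hm hL.1)).elim
    · exact ⟨θ, hθ, hθL, F, hI, h⟩
  · obtain ⟨F', hF', hs⟩ := hfin F hF
    exact ⟨F'.1, hs, F'.2, hΓ F' hF'⟩

end IsWorld

/-! ### The canonical structure -/

/-- The worlds of the canonical structure. -/
structure CanonicalWorld (n : ℕ) (Φ V : Type u) (k q : Prop) : Type u where
  /-- The primitive propositions of the world. -/
  lang : Set Φ
  /-- The true sentences. -/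
  truths : Set (Formula n Φ V)
  isWorld : IsWorld k q lang truths

open Classical in
/-- The canonical structure. -/
noncomputable def canonical (n : ℕ) (Φ V : Type u) (k q : Prop) : ExtStructure n Φ V where
  World := CanonicalWorld n Φ V k q
  lang s := s.lang
  lang_nonempty s := s.isWorld.nonempty
  val s p := decide (prim p ∈ s.truths)
  rel i s t := ∀ φ, K i φ ∈ s.truths ↔ K i φ ∈ t.truths
  aware i s := {φ | φ.IsSentence ∧ ∀ p ∈ φ.prims, A i (prim p) ∈ s.truths}
  aware_sentence _ _ _ h := h.1
  aware_lang _ s _ h p hp := s.isWorld.prims_subset (h.2 p hp) rfl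

section

variable [Countable Φ] [Countable V]

/-- The relation is equality of `K i`-theories, hence an equivalence; KA and T carry awareness
across it. -/
theorem isNrte_canonical : (canonical n Φ V k q).IsNrte where
  agpp i s φ hφ := by
    refine ⟨fun h p hp => ⟨rfl, fun r hr => ?_⟩, fun h => ⟨hφ, fun p hp => (h p hp).2 p rfl⟩⟩
    rw [show r = p from hr]
    exact h.2 p hp
  ka := by
    have hsub : ∀ i (s t : (canonical n Φ V k q).World), (canonical n Φ V k q).rel i s t →
        (canonical n Φ V k q).aware i s ⊆ (canonical n Φ V k q).aware i t := by
      intro i s t h φ hφ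
      exact ⟨hφ.1, fun p hp => t.isWorld.of_K_mem ((h _).1 (s.isWorld.K_A_mem (hφ.2 p hp)))⟩
    exact fun i s t h => (hsub i s t h).antisymm (hsub i t s fun φ => (h φ).symm)
  refl i s φ := Iff.rfl
  trans i s t u h₁ h₂ φ := (h₁ φ).trans (h₂ φ)
  eucl i s t u h₁ h₂ φ := (h₁ φ).symm.trans (h₂ φ)

/-- Truth in the canonical structure is membership, provided that unknown sentences fail at an
accessible world. -/
theorem sat_canonical [Nonempty V]
    (hex : ∀ (s : CanonicalWorld n Φ V k q) (i : Fin n) (φ : Formula n Φ V), Lng k q φ →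
      φ.prims ⊆ s.lang → K i φ ∉ s.truths → ∃ t : CanonicalWorld n Φ V k q,
        (∀ ψ, K i ψ ∈ s.truths ↔ K i ψ ∈ t.truths) ∧ φ ∉ t.truths)
    (φ : Formula n Φ V) (s : (canonical n Φ V k q).World) (hφ : Lng k q φ) :
    (canonical n Φ V k q).Sat (Rng n Φ V k) s φ ↔ φ ∈ s.truths := by
  have hprims : ∀ {s : (canonical n Φ V k q).World} {φ : Formula n Φ V}, φ ∈ s.truths →
      φ.prims ⊆ (canonical n Φ V k q).lang s := fun {s _} h => s.isWorld.prims_subset h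
  have hA : ∀ {s : (canonical n Φ V k q).World} {i : Fin n} {φ : Formula n Φ V},
      Lng k q (A i φ) → (φ ∈ (canonical n Φ V k q).aware i s ↔ A i φ ∈ s.truths) := by
    intro s i φ h
    rw [s.isWorld.A_mem h]
    exact and_iff_right (lng_A.1 h).2.1
  have hK : ∀ {s : (canonical n Φ V k q).World} {i : Fin n} {φ : Formula n Φ V},
      (∀ t : (canonical n Φ V k q).World, Lng k q φ →
        ((canonical n Φ V k q).Sat (Rng n Φ V k) t φ ↔ φ ∈ t.truths)) → Lng k q φ →
      φ.prims ⊆ (canonical n Φ V k q).lang s →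
      ((∀ t, (canonical n Φ V k q).rel i s t → (canonical n Φ V k q).Sat (Rng n Φ V k) t φ) ↔
        K i φ ∈ s.truths) := by
    intro s i φ ih hφ hL
    refine ⟨fun h => ?_, fun h t ht => (ih t hφ).2 (t.isWorld.of_K_mem ((ht φ).1 h))⟩
    by_contra hm
    obtain ⟨t, ht, hn⟩ := hex s i φ hφ hL hm
    exact hn ((ih t hφ).1 (h t ht))
  induction φ using instanceInduction generalizing s with
  | prim p =>
    classical
    rw [ExtStructure.Sat]
    refine ⟨fun h => of_decide_eq_true h.2, fun h => ⟨hprims h rfl, decide_eq_true h⟩⟩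
  | var x => exact (not_lng_var hφ).elim
  | neg φ ih =>
    rw [ExtStructure.Sat]
    by_cases hL : φ.prims ⊆ (canonical n Φ V k q).lang s
    · exact (and_iff_right hL).trans ((not_congr (ih s hφ)).trans (s.isWorld.neg_mem (lng_neg.1 hφ) hL).symm)
    · exact iff_of_false (fun h => hL h.1) fun h => hL (hprims h :)
  | and φ ψ ih₁ ih₂ =>
    rw [ExtStructure.Sat]
    exact (and_congr (ih₁ s (lng_and.1 hφ).1) (ih₂ s (lng_and.1 hφ).2)).trans
      s.isWorld.and_mem.symm
  | K i φ ih =>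
    rw [ExtStructure.Sat]
    by_cases hL : φ.prims ⊆ (canonical n Φ V k q).lang s
    · exact (and_iff_right hL).trans (hK ih hφ hL)
    · exact iff_of_false (fun h => hL h.1) fun h => hL (hprims h :)
  | A i φ ih =>
    rw [ExtStructure.sat_A]
    exact hA hφ
  | X i φ ih =>
    have hX := lng_X.1 hφ
    rw [ExtStructure.Sat]
    by_cases hL : φ.prims ⊆ (canonical n Φ V k q).lang s
    · rw [and_iff_right hL, and_iff_right hL, hA (lng_A.2 hX), hK ih hX.2 hL, and_comm]
      exact (s.isWorld.X_mem hφ hL).symm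
    · exact iff_of_false (fun h => hL h.1.1) fun h => hL (hprims h :)
  | all x φ ih =>
    rw [ExtStructure.Sat]
    by_cases hL : φ.prims ⊆ (canonical n Φ V k q).lang s
    · refine (and_iff_right hL).trans (Iff.trans ?_ (s.isWorld.all_mem hφ hL).symm)
      exact ⟨fun h θ hθ hθL => (ih θ hθ.1 s (hφ.substVar hθ)).1 (h θ hθ.1 hθ hθL),
        fun h θ hq hθ hθL => (ih θ hq s (hφ.substVar hθ)).2 (h θ hθ hθL)⟩
    · exact iff_of_false (fun h => hL h.1) fun h => hL (hprims h :)

end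

end Awareness

namespace Awareness

open Formula

variable {n : ℕ} {Φ V : Type u} {k q : Prop}

/-! ### Accessible worlds -/

/-- The sentences that agent `i` knows. -/
def known (i : Fin n) (Γ : Set (Formula n Φ V)) : Set (Formula n Φ V) := {φ | K i φ ∈ Γ}

/-- The primitive propositions that are defined in all worlds that agent `i` considers
possible. -/
def awarePrims (i : Fin n) (Γ : Set (Formula n Φ V)) : Set Φ := {p | Astar i (prim p) ∈ Γ}

namespace IsWorld

variable {L L' : Set Φ} {Γ Γ' : Set (Formula n Φ V)} {φ ψ : Formula n Φ V} {i : Fin n}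

theorem awarePrims_subset (h : IsWorld k q L Γ) : awarePrims i Γ ⊆ L := fun p hp => by
  have : p ∈ (Astar i (prim p : Formula n Φ V)).prims := by simp [prims]
  exact h.prims_subset hp this

variable [Countable Φ] [Countable V]

theorem known_subset (h : IsWorld k q L Γ) : known i Γ ⊆ Γ := fun _ hφ => h.of_K_mem hφ

theorem con_known (h : IsWorld k q L Γ) : Con k q (known i Γ) := h.con.mono h.known_subset

variable [Nonempty V]

theorem Astar_mem_iff (h : IsWorld k q L Γ) (hφ : Lng k q φ) :
    Astar i φ ∈ Γ ↔ φ.prims ⊆ awarePrims i Γ := h.Astar_mem hφ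

theorem prims_subset_of_known (h : IsWorld k q L Γ) (hφ : φ ∈ known i Γ) :
    φ.prims ⊆ awarePrims i Γ :=
  (h.Astar_mem_iff (lng_K.1 (h.lng hφ))).1 (h.Astar_mem_of_K_mem hφ)

/-- A derivation uses finitely many known sentences, all over star-aware propositions. So AGPP^*
makes the corresponding provable implication star-aware, Gen^* makes it known, and K discharges its
premises. -/
theorem K_mem_of_der (h : IsWorld k q L Γ) (hd : Der k q (known i Γ) φ)
    (hS : φ.prims ⊆ awarePrims i Γ) : K i φ ∈ Γ := by
  obtain ⟨l, hl, hP⟩ := hd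
  have hA : Astar i (impList l φ) ∈ Γ := by
    rw [h.Astar_mem_iff hP.lng, prims_impList_subset]
    exact ⟨fun ψ hψ => h.prims_subset_of_known (hl ψ hψ), hS⟩
  exact h.mem_of_der (Der.K_of_impList (Der.gen hP (h.der hA)) fun ψ hψ => h.der (hl ψ hψ))
    (hS.trans h.awarePrims_subset)

theorem con_insert_neg (h : IsWorld k q L Γ) (hφ : Lng k q φ) (hS : φ.prims ⊆ awarePrims i Γ)
    (hK : K i φ ∉ Γ) : Con k q (insert (neg φ) (known i Γ)) :=
  by_contra fun hc => hK (h.K_mem_of_der (der_of_not_con_neg hc hφ) hS)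

/-- A world at which all known sentences are true and at which the agent is aware of nothing new
is accessible. -/
theorem K_mem_iff_of_known_subset (h : IsWorld k q L Γ) (h' : IsWorld k q L' Γ')
    (hs : known i Γ ⊆ Γ') (hA : ∀ p, Astar i (prim p) ∈ Γ' → p ∈ awarePrims i Γ)
    (φ : Formula n Φ V) : K i φ ∈ Γ ↔ K i φ ∈ Γ' := by
  -- Forward is axiom 4. Backward, `φ` is over star-aware propositions of `Γ`, so if it were
  -- unknown, 5^* would make `¬K_i φ` known and hence true in `Γ'`.
  refine ⟨fun hm => hs (h.K_K_mem hm), fun hm => by_contra fun hn => ?_⟩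
  have hφ : Lng k q φ := lng_K.1 (h'.lng hm)
  have hS : φ.prims ⊆ awarePrims i Γ := fun p hp =>
    hA p ((h'.Astar_mem hφ).1 (h'.Astar_mem_of_K_mem hm) p hp)
  have hneg := (h.neg_mem (φ := K i φ) hφ (hS.trans h.awarePrims_subset)).2 hn
  have := hs (h.K_neg_K_mem hneg ((h.Astar_mem_iff hφ).2 hS))
  exact (h'.neg_mem (φ := K i φ) hφ (h'.prims_subset hm :)).1 this hm

/-- If every instance by sentences that the agent is aware of follows from what is known, then so
does the instance by a new primitive proposition, on the assumption that the agent is aware of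
it. -/
theorem der_imp_instance [Infinite V] (hq : q) (h : IsWorld k q L Γ) (T : Finset Φ) {y : V}
    {χ : Formula n Φ V} (hχ : Lng k q (all y χ)) (hT : χ.prims ⊆ awarePrims i Γ ∪ T)
    (hθ : ∀ θ ∈ Rng n Φ V k, θ.prims ⊆ awarePrims i Γ → Der k q (known i Γ) (χ.substVar y θ))
    {p : Φ} (hpT : p ∉ T) :
    Der k q (known i Γ) (imp (Astar i (prim p)) (χ.substVar y (prim p))) := by
  classical
  induction T using Finset.induction_on generalizing χ with
  | empty =>
    rw [Finset.coe_empty, Set.union_empty] at hT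
    have hχ' := lng_all.1 hχ
    -- Here `χ` is over star-aware propositions. The hypothesis puts `Ψ` into `Γ`; by T so is `¬K_i
    -- ¬Ψ`, and by 5^* it is known. Now the Barcan argument applies to the known sentences.
    set Ψ : Formula n Φ V := all y (imp (Astar i (var y)) (K i χ)) with hΨ
    have hΨp : Ψ.prims = χ.prims := by simp [hΨ, prims]
    have hLΨ : Lng k q Ψ := by
      refine lng_all.2 ⟨hq, ?_, fun hk => ⟨⟨trivial, trivial⟩, hχ'.2.2 hk⟩⟩
      simp only [imp, Formula.or, Astar, free, Set.union_self]
      exact Set.union_subset subset_rfl hχ'.2.1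
    have hSL := h.awarePrims_subset (i := i)
    have hΨm : Ψ ∈ Γ := by
      rw [h.all_mem hLΨ (hΨp.subset.trans (hT.trans hSL))]
      intro θ hR hθL
      simp only [substVar_imp, substVar_Astar, substVar_var_self, substVar_K]
      have hLθ : Lng k q θ := lng_of_mem_rng hR
      have hLχ : Lng k q (χ.substVar y θ) := hχ.substVar hR
      have hsub := prims_substVar_subset y χ θ
      have hL : (imp (Astar i θ) (K i (χ.substVar y θ))).prims ⊆ L := by
        rw [prims_imp, prims_Astar]
        exact Set.union_subset hθL (hsub.trans (Set.union_subset (hT.trans hSL) hθL))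
      by_cases hA : Astar i θ ∈ Γ
      · have hθS := (h.Astar_mem_iff hLθ).1 hA
        have hK := h.K_mem_of_der (hθ θ hR hθS) (hsub.trans (Set.union_subset hT hθS))
        refine h.mem_of_der ((h.der hK).taut₁ (by simp [hLθ, hLχ]) fun v hv hv' => ?_) hL
        exact (hv.imp _ _).2 fun _ => hv'
      · have hn := (h.neg_mem (by simpa using hLθ) (by simpa using hθL)).2 hA
        refine h.mem_of_der ((h.der hn).taut₁ (by simp [hLθ, hLχ]) fun v hv hv' => ?_) hL
        exact (hv.imp _ _).2 fun h => ((hv.neg _).1 hv' h).elim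
    have hΨL := h.prims_subset hΨm
    have hn : neg (K i (neg Ψ)) ∈ Γ := by
      refine (h.neg_mem (φ := K i (neg Ψ)) hLΨ hΨL).2 fun hm => ?_
      exact (h.neg_mem hLΨ hΨL).1 (h.of_K_mem hm) hΨm
    have hAn : Astar i (neg Ψ) ∈ Γ := (h.Astar_mem_iff (φ := neg Ψ) hLΨ).2 (hΨp.subset.trans hT)
    have hAχ : Astar i (all y χ) ∈ Γ := (h.Astar_mem_iff hχ).2 hT
    refine Der.barcan hχ (.of_mem (h.K_neg_K_mem hn hAn) hLΨ)
      (.of_mem (h.K_K_mem hAχ) (by simpa using hχ))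
  | insert r T _ ih =>
    simp only [Finset.mem_insert, not_or] at hpT
    by_cases hr : r ∈ awarePrims i Γ
    · refine ih hχ (fun s hs => ?_) hθ hpT.2
      rcases hT hs with h | h
      · exact .inl h
      · rcases Finset.mem_insert.1 h with rfl | h
        · exact .inl hr
        · exact .inr h
    -- Remove the foreign proposition `r` by binding it with an unused variable `z`. Since `r`
    -- occurs in no known sentence, the hypothesis generalizes; after the induction, instantiating
    -- `z` by `r` gives the claim back.
    · obtain ⟨z, hz⟩ := (χ.finite_vars.union (Set.finite_singleton y)).infinite_compl.nonempty
      simp only [Set.mem_compl_iff, Set.mem_union, Set.mem_singleton_iff, not_or] at hz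
      have hχ' := lng_all.1 hχ
      have hsubst : ∀ θ : Formula n Φ V, θ.QuantFree → r ∉ θ.prims →
          (all z (χ.substPrim r (var z))).substVar y θ =
            all z ((χ.substVar y θ).substPrim r (var z)) := by
        intro θ _ hrθ
        rw [← substVar_substPrim_comm (fun h => hz.2 h.symm) hrθ]
        simp [substVar, hz.2]
      have hvars : ∀ θ : Formula n Φ V, θ.QuantFree → z ∉ (χ.substVar y θ).vars :=
        fun θ hθ hm => hz.1 (vars_substVar_subset hθ y χ hm)
      have hih := ih (χ := all z (χ.substPrim r (var z))) (lng_all.2 ⟨hq, ?_, fun hk =>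
        (hχ'.2.2 hk).substPrim_var r z⟩) ?_ (fun θ hR hθS => ?_) hpT.2
      · rw [hsubst (prim p) trivial (by simpa [prims] using fun h => hpT.1 h.symm)] at hih
        have hLp : Lng k q (Astar i (prim p : Formula n Φ V)) := by simp
        have hm := (hih.mono (Set.subset_insert (Astar i (prim p)) _)).mp
          (.of_mem (.inl rfl) hLp)
        have := hm.inst_all (prim_mem_rng r)
        rw [substVar_substPrim_var r (hvars (prim p) trivial)] at this
        exact this.deduction hLp
      · rintro x ⟨hx, hxz⟩
        rcases free_substPrim_var_subset r z χ hx with h | h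
        · exact hχ'.2.1 h
        · exact (hxz h).elim
      · rw [prims, prims_substPrim_var]
        rintro s ⟨hs, hsr⟩
        rcases hT hs with h | h
        · exact .inl h
        · exact .inr ((Finset.mem_insert.1 h).resolve_left hsr)
      · rw [hsubst θ hR.1 fun h => hr (hθS h)]
        exact (hθ θ hR hθS).generalize hq (fun ψ hψ hm => hr (h.prims_subset_of_known hψ hm))
          (substitutable_of_notMem_vars r (hvars θ hR.1))

end IsWorld

end Awareness

/-! ### Accessible worlds over star-aware and new propositions -/

namespace Awareness

open Formula

variable {n : ℕ} {Φ V : Type u} {k q : Prop}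

/-- The primitive propositions that occur in a finite set of sentences. -/
noncomputable def finsetPrims (F : Finset (Formula n Φ V)) : Finset Φ :=
  open Classical in F.biUnion fun φ => φ.finite_prims.toFinset

theorem mem_finsetPrims {F : Finset (Formula n Φ V)} {p : Φ} :
    p ∈ finsetPrims F ↔ ∃ φ ∈ F, p ∈ φ.prims := by
  classical
  simp [finsetPrims]

namespace IsWorld

variable [Countable Φ] [Countable V] {L : Set Φ} {Γ : Set (Formula n Φ V)}
  {φ ψ : Formula n Φ V} {i : Fin n}

/-- The admissible finite sets are those that extend `F₁`, are consistent with what is known, and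
contain `¬A_i^* r` for every `r ∈ Q` that occurs in them. The last condition keeps the agent from
being star-aware of anything new, which is what makes the resulting world accessible. -/
theorem exists_accessible_of_new [Infinite V] (hq : q) (h : IsWorld k q L Γ)
    {Q : Set Φ} (hQL : Q ⊆ Lᶜ) (hne : (awarePrims i Γ ∪ Q).Nonempty)
    (hco : (awarePrims i Γ ∪ Q)ᶜ.Infinite) {F₁ : Finset (Formula n Φ V)}
    (hF₁ : ∀ φ ∈ F₁, Lng k q φ ∧ φ.prims ⊆ awarePrims i Γ) (hcon : Con k q (known i Γ ∪ F₁))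
    {x : V} (hU : (all x (Astar i (var x)) ∈ F₁ ∧ Q = ∅) ∨
      (neg (all x (Astar i (var x))) ∈ F₁ ∧ Q.Infinite)) :
    ∃ Γ', IsWorld k q (awarePrims i Γ ∪ Q) Γ' ∧ (∀ φ, K i φ ∈ Γ ↔ K i φ ∈ Γ') ∧
      (F₁ : Set (Formula n Φ V)) ⊆ Γ' := by
  classical
  have hSQ : ∀ p ∈ Q, p ∉ awarePrims i Γ := fun p hp hS => hQL hp (h.awarePrims_subset hS)
  have hLU : Lng k q (all x (Astar i (var x : Formula n Φ V))) :=
    lng_all.2 ⟨hq, by simp [Astar, Formula.or, free], fun _ => ⟨trivial, trivial⟩⟩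
  have hcoe : ∀ (F : Finset (Formula n Φ V)) (φ : Formula n Φ V),
      known i Γ ∪ ((insert φ F : Finset (Formula n Φ V)) : Set (Formula n Φ V)) =
        insert φ (known i Γ ∪ F) := fun F φ => by rw [Finset.coe_insert, Set.union_insert]
  let ok : Finset (Formula n Φ V) → Prop := fun F => F₁ ⊆ F ∧
    (∀ φ ∈ F, Lng k q φ ∧ φ.prims ⊆ awarePrims i Γ ∪ Q) ∧ Con k q (known i Γ ∪ F) ∧
    ∀ φ ∈ F, ∀ r ∈ φ.prims, r ∈ Q → neg (Astar i (prim r)) ∈ F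
  have hok₁ : ok F₁ := ⟨subset_rfl, fun φ hφ => ⟨(hF₁ φ hφ).1, (hF₁ φ hφ).2.trans
    Set.subset_union_left⟩, hcon, fun φ hφ r hr hrQ => (hSQ r hrQ ((hF₁ φ hφ).2 hr)).elim⟩
  have hinsert : ∀ F φ, ok F → Lng k q φ → φ.prims ⊆ awarePrims i Γ ∪ Q →
      (∀ r ∈ φ.prims, r ∈ Q → neg (Astar i (prim r)) ∈ insert φ F) →
      Con k q (insert φ (known i Γ ∪ F)) → ok (insert φ F) := by
    intro F φ hF hφ hp hr hc
    refine ⟨hF.1.trans (Finset.subset_insert _ _), ?_, by rwa [hcoe], ?_⟩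
    · rw [Finset.forall_mem_insert]
      exact ⟨⟨hφ, hp⟩, hF.2.1⟩
    · rw [Finset.forall_mem_insert]
      exact ⟨hr, fun ψ hψ r hr hrQ => Finset.mem_insert_of_mem (hF.2.2.2 ψ hψ r hr hrQ)⟩
  have hfresh : ∀ (F : Finset (Formula n Φ V)) (p : Φ), p ∉ awarePrims i Γ →
      p ∉ finsetPrims F → ∀ ψ ∈ known i Γ ∪ F, p ∉ ψ.prims := by
    rintro F p hpS hpF ψ (hψ | hψ) hp
    · exact hpS (h.prims_subset_of_known hψ hp)
    · exact hpF (mem_finsetPrims.2 ⟨ψ, hψ, hp⟩)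
  have hadd : ∀ F r, ok F → r ∈ Q → r ∉ finsetPrims F →
      ok (insert (neg (Astar i (prim r))) F) := by
    intro F r hF hr hrF
    refine hinsert F _ hF (by simp) (by simpa [prims] using .inr hr) (by simp [prims]) ?_
    -- Otherwise `A_i^* r` would be derivable for a fresh `r`, hence also `∀x A_i^* x`, whose
    -- negation is in `F₁` when `Q` is nonempty.
    by_contra hc
    have hd := der_of_not_con_neg hc (by simp)
    have hall : Der k q (known i Γ ∪ F) (all x (Astar i (var x))) :=
      Der.all_of_instance (p := r) hq (hfresh F r (hSQ r hr) hrF) (by simp [prims])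
        (by simpa using hd)
    rcases hU with hU | hU
    · rw [hU.2] at hr
      exact hr
    · exact hF.2.2.1 _ hall (.of_mem (.inr (hF.1 hU.1)) hLU)
  have haddSet : ∀ (T : Finset Φ), (T : Set Φ) ⊆ Q → ∀ F, ok F →
      ∃ F', F ⊆ F' ∧ ok F' ∧ ∀ r ∈ T, neg (Astar i (prim r)) ∈ F' := by
    intro T
    induction T using Finset.induction_on with
    | empty => exact fun _ F hF => ⟨F, subset_rfl, hF, by simp⟩
    | insert r T _ ih =>
      intro hT F hF
      rw [Finset.coe_insert, Set.insert_subset_iff] at hT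
      obtain ⟨F', hFF', hF', hT'⟩ := ih hT.2 F hF
      by_cases hr : r ∈ finsetPrims F'
      · obtain ⟨φ, hφ, hrφ⟩ := mem_finsetPrims.1 hr
        exact ⟨F', hFF', hF', by simpa using ⟨hF'.2.2.2 φ hφ r hrφ hT.1, hT'⟩⟩
      · refine ⟨_, hFF'.trans (Finset.subset_insert _ _), hadd F' r hF' hT.1 hr, ?_⟩
        rw [Finset.forall_mem_insert]
        exact ⟨Finset.mem_insert_self _ _, fun s hs => Finset.mem_insert_of_mem (hT' s hs)⟩
  have hdecide : ∀ F φ, ok F → Lng k q φ → φ.prims ⊆ awarePrims i Γ ∪ Q →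
      ∃ F', F ⊆ F' ∧ ok F' ∧ (φ ∈ F' ∨ neg φ ∈ F') := by
    intro F φ hF hφ hp
    -- Before deciding `φ`, exclude star-awareness of its propositions in `Q`; then adding either
    -- `φ` or its negation preserves admissibility.
    obtain ⟨F', hFF', hF', hT⟩ := haddSet (φ.finite_prims.inter_of_left Q).toFinset (by simp) F hF
    have hr : ∀ ψ, ∀ r ∈ φ.prims, r ∈ Q → neg (Astar i (prim r)) ∈ insert ψ F' :=
      fun ψ r hr hrQ => Finset.mem_insert_of_mem (hT r (by simp [hr, hrQ]))
    rcases hF'.2.2.1.insert_or hφ with hc | hc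
    · exact ⟨_, hFF'.trans (Finset.subset_insert _ _), hinsert F' φ hF' hφ hp (hr φ) hc,
        .inl (Finset.mem_insert_self _ _)⟩
    · exact ⟨_, hFF'.trans (Finset.subset_insert _ _), hinsert F' (neg φ) hF' hφ hp (hr _) hc,
        .inr (Finset.mem_insert_self _ _)⟩
  have hcounter : ∀ F y ψ, ok F → neg (all y ψ) ∈ F → ∃ F', F ⊆ F' ∧ ok F' ∧
      ∃ θ ∈ Rng n Φ V k, θ.prims ⊆ awarePrims i Γ ∪ Q ∧ neg (ψ.substVar y θ) ∈ F' := by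
    intro F y ψ hF hm
    have hLψ : Lng k q (all y ψ) := (hF.2.1 _ hm).1
    have hpψ : ψ.prims ⊆ awarePrims i Γ ∪ Q := (hF.2.1 _ hm).2
    have hψF : ψ.prims ⊆ finsetPrims F := fun r hr => mem_finsetPrims.2 ⟨_, hm, hr⟩
    have hLF : ∀ φ ∈ F.toList, Lng k q φ := fun φ hφ => (hF.2.1 φ (by simpa using hφ)).1
    by_cases hex : ∃ θ ∈ Rng n Φ V k, θ.prims ⊆ awarePrims i Γ ∧
        Con k q (insert (neg (ψ.substVar y θ)) (known i Γ ∪ F))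
    · obtain ⟨θ, hR, hθS, hc⟩ := hex
      have hsub := prims_substVar_subset y ψ θ
      refine ⟨_, Finset.subset_insert _ _, hinsert F (neg (ψ.substVar y θ)) hF (hLψ.substVar hR) ?_
        ?_ hc, θ, hR, hθS.trans Set.subset_union_left, Finset.mem_insert_self _ _⟩
      · exact hsub.trans (Set.union_subset hpψ (hθS.trans Set.subset_union_left))
      · intro r hr hrQ
        rcases hsub hr with hr | hr
        · exact Finset.mem_insert_of_mem (hF.2.2.2 _ hm r hr hrQ)
        · exact (hSQ r hrQ (hθS hr)).elim
    push Not at hex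
    -- Every instance over star-aware propositions is now derivable. Moving the sentences of `F`
    -- into the conclusion leaves only known premises, and the propositions of `F` form the finite
    -- exceptional set.
    have hinst : ∀ p ∉ finsetPrims F, Der k q (known i Γ ∪ F)
        (imp (Astar i (prim p)) (ψ.substVar y (prim p))) := by
      intro p hp
      have hd := h.der_imp_instance hq (finsetPrims F) (i := i) (y := y)
        (χ := impList F.toList ψ) (p := p) ?_ ?_ (fun θ hR hθS => ?_) hp
      · rw [substVar_impList fun φ hφ => (hLF φ hφ).1] at hd
        have hA : Lng k q (Astar i (prim p : Formula n Φ V)) := by simp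
        have hd' := (hd.mono ((Set.subset_union_left (t := (F : Set (Formula n Φ V)))).trans
          (Set.subset_insert (Astar i (prim p)) _))).mp (.of_mem (.inl rfl) hA)
        refine (hd'.of_impList fun φ hφ => ?_).deduction hA
        exact .of_mem (.inr (.inr (by simpa using hφ))) (hLF φ hφ)
      · have hψ' := lng_all.1 hLψ
        have hfree : ∀ l : List (Formula n Φ V), (∀ φ ∈ l, Lng k q φ) →
            (impList l ψ).free ⊆ {y} ∧ (k → (impList l ψ).KOnly) := by
          intro l hl
          induction l with
          | nil => exact hψ'.2
          | cons a l ih =>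
            have ha := hl a (by simp)
            have := ih fun φ hφ => hl φ (by simp [hφ])
            refine ⟨Set.union_subset ?_ this.1, fun hk => ⟨ha.2.1 hk, this.2 hk⟩⟩
            exact (Set.subset_empty_iff.2 ha.1).trans (Set.empty_subset _)
        exact lng_all.2 ⟨hq, hfree _ hLF⟩
      · rw [prims_impList_subset]
        refine ⟨fun φ hφ r hr => .inr ?_, fun r hr => .inr (hψF hr)⟩
        exact mem_finsetPrims.2 ⟨φ, by simpa using hφ, hr⟩
      · rw [substVar_impList fun φ hφ => (hLF φ hφ).1]
        refine Der.to_impList hLF ?_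
        have := der_of_not_con_neg (hex θ hR hθS) (hLψ.substVar hR)
        refine this.mono (Set.union_subset_union_right _ fun φ hφ => ?_)
        exact Finset.mem_toList.2 hφ
    have hcontra : ∀ p ∉ awarePrims i Γ, p ∉ finsetPrims F →
        ¬ Der k q (known i Γ ∪ F) (ψ.substVar y (prim p)) := fun p hpS hpF hd =>
      hF.2.2.1 _ (hd.all_of_instance hq (hfresh F p hpS hpF) fun hp => hpF (hψF hp))
        (.of_mem (.inr hm) hLψ)
    rcases hU with hU | hU
    -- This `p` lies outside the language of the new world: it serves only to show that the present
    -- case is contradictory.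
    · obtain ⟨p, hp, hpF⟩ := hco.exists_notMem_finset (finsetPrims F)
      have hpS : p ∉ awarePrims i Γ := fun hS => hp (.inl hS)
      have hall : Der k q (known i Γ ∪ F) (all x (Astar i (var x))) :=
        .of_mem (.inr (hF.1 hU.1)) hLU
      have hA := hall.inst_all (prim_mem_rng p)
      rw [substVar_Astar, substVar_var_self] at hA
      exact (hcontra p hpS hpF ((hinst p hpF).mp hA)).elim
    · obtain ⟨p, hp, hpF⟩ := hU.2.exists_notMem_finset (finsetPrims F)
      have hLp := hLψ.substVar (prim_mem_rng (n := n) (V := V) p)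
      have hsub := prims_substVar_subset y ψ (prim p)
      refine ⟨_, (Finset.subset_insert _ _).trans (Finset.subset_insert _ _),
        hinsert _ (neg (ψ.substVar y (prim p))) (hadd F p hF hp hpF) hLp ?_ ?_ ?_, prim p,
        prim_mem_rng p, by simpa [prims] using .inr hp, Finset.mem_insert_self _ _⟩
      · exact hsub.trans (Set.union_subset hpψ (by simpa [prims] using .inr hp))
      · intro r hr hrQ
        rcases hsub hr with hr | hr
        · exact Finset.mem_insert_of_mem (Finset.mem_insert_of_mem (hF.2.2.2 _ hm r hr hrQ))
        · rw [show r = p from hr]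
          exact Finset.mem_insert_of_mem (Finset.mem_insert_self _ _)
      -- If this were inconsistent, `ψ[y/p]` would follow from `A_i^* p` and from its negation
      -- alike, and would generalize to `∀y ψ`.
      · by_contra hc
        have hd := der_of_not_con_neg hc hLp
        rw [hcoe] at hd
        have hd' := hd.deduction (by simp)
        refine hcontra p (hSQ p hp) hpF (Der.taut₂ (hinst p hpF) hd' hLp fun v hv h₁ h₂ => ?_)
        rw [hv.imp] at h₁ h₂
        rw [hv.neg] at h₂
        tauto
  obtain ⟨Γ', hW, hF₁Γ', hdir⟩ := exists_of_family hne hco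
    (fun F hF => hF.2.2.1.mono Set.subset_union_right) (fun F hF => hF.2.1) hdecide hcounter hok₁
  refine ⟨Γ', hW, h.K_mem_iff_of_known_subset hW (fun φ hφ => ?_) (fun p hp => ?_), hF₁Γ'⟩
  · have hLφ : Lng k q φ := lng_K.1 (h.lng hφ)
    refine (hW.mem_or hLφ ((h.prims_subset_of_known hφ).trans
      Set.subset_union_left)).resolve_right fun hn => ?_
    obtain ⟨F, hs, hF, -⟩ := hdir {neg φ} (by simpa using hn)
    exact hF.2.2.1 φ (.of_mem (.inl hφ) hLφ) (.of_mem (.inr (hs (by simp))) hLφ)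
  · have hpL : p ∈ awarePrims i Γ ∪ Q := hW.prims_subset hp (by simp [prims])
    refine hpL.resolve_right fun hpQ => ?_
    obtain ⟨F, hs, hF, -⟩ := hdir {Astar i (prim p)} (by simpa using hp)
    have hmem : Astar i (prim p) ∈ F := hs (by simp)
    have hn := hF.2.2.2 _ hmem p (by simp [prims]) hpQ
    exact hF.2.2.1 _ (.of_mem (.inr hmem) (by simp)) (.of_mem (.inr hn) (by simp))

end IsWorld

end Awareness

namespace Awareness

open Formula

variable {n : ℕ} {Φ V : Type u} {k q : Prop}

/-! ### Existence of worlds -/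

/-- Splits a reservoir of propositions: one half is used for the new world, the other remains
outside its language. -/
theorem exists_infinite_subset_diff {s : Set Φ} (hs : s.Infinite) :
    ∃ t ⊆ s, t.Infinite ∧ (s \ t).Infinite := by
  obtain ⟨t, u, htu, hdisj, hcard⟩ := hs.exists_union_disjoint_cardinal_eq_of_infinite
  obtain ⟨e⟩ := Cardinal.eq.1 hcard
  have htu' : t.Finite ↔ u.Finite := e.finite_iff
  have ht : t.Infinite := fun ht => hs (htu ▸ ht.union (htu'.1 ht))
  refine ⟨t, htu ▸ Set.subset_union_left, ht, fun hu => ht (htu'.2 (hu.subset ?_))⟩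
  exact fun p hp => ⟨htu ▸ .inr hp, fun hpt => Set.disjoint_left.1 hdisj hpt hp⟩

namespace IsWorld

variable [Countable Φ] [Countable V] {L : Set Φ} {Γ : Set (Formula n Φ V)}
  {φ ψ : Formula n Φ V} {i : Fin n}

/-- A consistent set of sentences extends to a world if, in the presence of quantifiers, there are
infinitely many primitive propositions for new counterexamples. -/
theorem exists_of_con {B : Set (Formula n Φ V)} (hne : L.Nonempty) (hco : Lᶜ.Infinite)
    (hB : ∀ φ ∈ B, Lng k q φ ∧ φ.prims ⊆ L) (hcon : Con k q B)
    (hnew : q → {p ∈ L | ∀ ψ ∈ B, p ∉ ψ.prims}.Infinite) :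
    ∃ Γ, IsWorld k q L Γ ∧ B ⊆ Γ := by
  classical
  have hcoe : ∀ (F : Finset (Formula n Φ V)) (φ : Formula n Φ V),
      B ∪ ((insert φ F : Finset (Formula n Φ V)) : Set (Formula n Φ V)) =
        insert φ (B ∪ F) := fun F φ => by rw [Finset.coe_insert, Set.union_insert]
  let ok : Finset (Formula n Φ V) → Prop := fun F =>
    (∀ φ ∈ F, Lng k q φ ∧ φ.prims ⊆ L) ∧ Con k q (B ∪ F)
  have hinsert : ∀ F φ, ok F → Lng k q φ → φ.prims ⊆ L →
      Con k q (insert φ (B ∪ F)) → ok (insert φ F) := by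
    intro F φ hF hφ hp hc
    refine ⟨?_, by rwa [hcoe]⟩
    rw [Finset.forall_mem_insert]
    exact ⟨⟨hφ, hp⟩, hF.1⟩
  have hdecide : ∀ F φ, ok F → Lng k q φ → φ.prims ⊆ L →
      ∃ F', F ⊆ F' ∧ ok F' ∧ (φ ∈ F' ∨ neg φ ∈ F') := by
    intro F φ hF hφ hp
    rcases hF.2.insert_or hφ with hc | hc
    · exact ⟨_, Finset.subset_insert _ _, hinsert F φ hF hφ hp hc,
        .inl (Finset.mem_insert_self _ _)⟩
    · exact ⟨_, Finset.subset_insert _ _, hinsert F (neg φ) hF hφ hp hc,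
        .inr (Finset.mem_insert_self _ _)⟩
  have hcounter : ∀ F y ψ, ok F → neg (all y ψ) ∈ F → ∃ F', F ⊆ F' ∧ ok F' ∧
      ∃ θ ∈ Rng n Φ V k, θ.prims ⊆ L ∧ neg (ψ.substVar y θ) ∈ F' := by
    intro F y ψ hF hm
    have hLψ : Lng k q (all y ψ) := (hF.1 _ hm).1
    have hpψ : ψ.prims ⊆ L := (hF.1 _ hm).2
    have hq := (lng_all.1 hLψ).1
    -- The counterexample is a proposition of `L` occurring neither in `B` nor in the current finite
    -- set.
    obtain ⟨p, ⟨hpL, hpB⟩, hpF⟩ := (hnew hq).exists_notMem_finset (finsetPrims F)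
    have hpL' : (prim p : Formula n Φ V).prims ⊆ L := by simpa [prims] using hpL
    refine ⟨_, Finset.subset_insert _ _, hinsert F (neg (ψ.substVar y (prim p))) hF
      (hLψ.substVar (prim_mem_rng p)) ((prims_substVar_subset y ψ _).trans
        (Set.union_subset hpψ hpL')) ?_, prim p, prim_mem_rng p, hpL', Finset.mem_insert_self _ _⟩
    by_contra hc
    have hd := der_of_not_con_neg hc (hLψ.substVar (prim_mem_rng p))
    have hψF : p ∉ ψ.prims := fun hp => hpF (mem_finsetPrims.2 ⟨_, hm, hp⟩)
    refine hF.2 _ (hd.all_of_instance hq ?_ hψF)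
      (.of_mem (.inr hm) hLψ)
    rintro χ (hχ | hχ)
    · exact hpB χ hχ
    · exact fun hp => hpF (mem_finsetPrims.2 ⟨χ, hχ, hp⟩)
  obtain ⟨Γ, hW, -, hdir⟩ := exists_of_family (ok := ok) (F₀ := ∅) hne hco
    (fun F hF => hF.2.mono Set.subset_union_right) (fun F hF => hF.1) hdecide hcounter
    ⟨by simp, by simpa using hcon⟩
  refine ⟨Γ, hW, fun φ hφ => ?_⟩
  refine (hW.mem_or (hB φ hφ).1 (hB φ hφ).2).resolve_right fun hn => ?_
  obtain ⟨F, hs, hF, -⟩ := hdir {neg φ} (by simpa using hn)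
  exact hF.2 φ (.of_mem (.inl hφ) (hB φ hφ).1) (.of_mem (.inr (hs (by simp))) (hB φ hφ).1)

/-- An unprovable sentence fails at some world. -/
theorem exists_of_not_pr [Infinite Φ] (hφ : Lng k q φ) (hn : ¬ Pr k q φ) :
    ∃ L Γ, IsWorld k q L Γ ∧ φ.prims ⊆ L ∧ φ ∉ Γ := by
  obtain ⟨t, ht, hti, hto⟩ := exists_infinite_subset_diff φ.finite_prims.infinite_compl
  have hcon : Con k q {neg φ} := by
    by_contra hc
    rw [← insert_empty_eq] at hc
    obtain ⟨l, hl, hP⟩ := der_of_not_con_neg hc hφ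
    rw [List.eq_nil_iff_forall_not_mem.2 hl] at hP
    exact hn hP
  obtain ⟨Γ, hW, hΓ⟩ := exists_of_con (L := φ.prims ∪ t) (hti.nonempty.mono Set.subset_union_right)
    (hto.mono fun p hp => not_or.2 hp) (B := {neg φ})
    (by simpa using ⟨hφ, (Set.subset_union_left :)⟩) hcon
    fun _ => hti.mono fun p hp => ⟨.inr hp, by simpa [prims] using ht hp⟩
  refine ⟨_, Γ, hW, Set.subset_union_left, ?_⟩
  exact (hW.neg_mem hφ Set.subset_union_left).1 (hΓ rfl)

/-- In the presence of quantifiers, consistency with what is known yields an accessible world. -/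
theorem exists_accessible_of_quant [Infinite V] (hq : q) (h : IsWorld k q L Γ)
    {F₀ : Finset (Formula n Φ V)} (hF₀ : ∀ φ ∈ F₀, Lng k q φ ∧ φ.prims ⊆ awarePrims i Γ)
    (hcon : Con k q (known i Γ ∪ F₀)) :
    ∃ L' Γ', IsWorld k q L' Γ' ∧ (∀ φ, K i φ ∈ Γ ↔ K i φ ∈ Γ') ∧
      (F₀ : Set (Formula n Φ V)) ⊆ Γ' ∧ L' ⊆ awarePrims i Γ ∪ Lᶜ := by
  classical
  obtain ⟨x⟩ : Nonempty V := inferInstance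
  have hLU : Lng k q (all x (Astar i (var x : Formula n Φ V))) :=
    lng_all.2 ⟨hq, by simp [Astar, Formula.or, free], fun _ => ⟨trivial, trivial⟩⟩
  have hpU : (all x (Astar i (var x : Formula n Φ V))).prims = ∅ := by simp [prims]
  have hcoe : ∀ φ : Formula n Φ V,
      insert φ (known i Γ ∪ F₀) =
        known i Γ ∪ ((insert φ F₀ : Finset (Formula n Φ V)) : Set (Formula n Φ V)) :=
    fun φ => by rw [Finset.coe_insert, Set.union_insert]
  rcases hcon.insert_or hLU with hc | hc
  -- The new language `S` must be nonempty. If it were empty, `∀x ¬A_i^* x` would be in `Γ` and, by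
  -- FA^*, known, which contradicts `∀x A_i^* x`.
  · have hS : (awarePrims i Γ).Nonempty := by
      by_contra hS
      rw [Set.not_nonempty_iff_eq_empty] at hS
      obtain ⟨p, hp⟩ := h.nonempty
      set N : Formula n Φ V := all x (neg (Astar i (var x))) with hN
      have hLN : Lng k q N :=
        lng_all.2 ⟨hq, by simp [Astar, Formula.or, free], fun _ => ⟨trivial, trivial⟩⟩
      have hpN : N.prims = ∅ := by simp [hN, prims]
      have hNΓ : N ∈ Γ := by
        rw [h.all_mem hLN (by simp [prims])]
        intro θ hR hθL
        rw [substVar_neg, substVar_Astar, substVar_var_self]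
        have hLθ : Lng k q θ := lng_of_mem_rng hR
        refine (h.neg_mem (by simpa using hLθ) (by simpa using hθL)).2 fun hA => ?_
        rw [h.Astar_mem_iff hLθ, hS, Set.subset_empty_iff] at hA
        exact hR.1.prims_nonempty.ne_empty hA
      have hFA : Pr k q (imp N (K i N)) :=
        .of_schemesAllK hq (.inr ⟨i, x, rfl⟩) (by simpa using hLN)
      have hKN : K i N ∈ Γ :=
        h.mem_of_der (hFA.der.mp (h.der hNΓ)) (by rw [prims, hpN]; exact Set.empty_subset _)
      have h₁ : Der k q (insert (all x (Astar i (var x))) (known i Γ ∪ F₀))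
          (all x (Astar i (var x))) := .of_mem (.inl rfl) hLU
      have h₂ : Der k q (insert (all x (Astar i (var x))) (known i Γ ∪ F₀)) N :=
        .of_mem (.inr (.inl hKN)) hLN
      exact hc _ (h₁.inst_all (prim_mem_rng p)) (h₂.inst_all (prim_mem_rng p))
    rw [hcoe] at hc
    obtain ⟨Γ', hW, hrel, hs⟩ := h.exists_accessible_of_new hq (Q := ∅) (Set.empty_subset _)
      (by simpa using hS)
      (h.infinite_compl.mono (Set.compl_subset_compl.2 (by simpa using h.awarePrims_subset)))
      (by
        rw [Finset.forall_mem_insert]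
        exact ⟨⟨hLU, by simp [hpU]⟩, hF₀⟩) hc (.inl ⟨Finset.mem_insert_self _ _, rfl⟩)
    refine ⟨_, Γ', hW, hrel, fun φ hφ => hs (Finset.mem_insert_of_mem hφ), ?_⟩
    rw [Set.union_empty]
    exact Set.subset_union_left
  · rw [hcoe] at hc
    obtain ⟨Q, hQ, hQi, hQo⟩ := exists_infinite_subset_diff h.infinite_compl
    obtain ⟨Γ', hW, hrel, hs⟩ := h.exists_accessible_of_new hq (Q := Q) hQ
      (hQi.nonempty.mono Set.subset_union_right)
      (hQo.mono fun p hp => not_or.2 ⟨fun hS => hp.1 (h.awarePrims_subset hS), hp.2⟩)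
      (by
        rw [Finset.forall_mem_insert]
        exact ⟨⟨hLU, by simp [prims]⟩, hF₀⟩) hc (.inr ⟨Finset.mem_insert_self _ _, hQi⟩)
    exact ⟨_, Γ', hW, hrel, fun φ hφ => hs (Finset.mem_insert_of_mem hφ),
      Set.union_subset_union_right _ hQ⟩

end IsWorld

/-- Awareness of a primitive proposition is not provable. -/
theorem not_pr_Astar [Countable Φ] [Infinite Φ] (i : Fin n) (r : Φ) :
    ¬ Pr k q (Astar i (prim r : Formula n Φ V)) := by
  intro h
  -- Two worlds, all related to each other, with `r` undefined at exactly one of them.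
  let M : ExtStructure n Φ V :=
    { World := ULift Bool
      lang := fun s => {p | s.down = true ∨ p ≠ r}
      lang_nonempty := fun s => (exists_ne r).imp fun p hp => .inr hp
      val := fun _ _ => false
      rel := fun _ _ _ => True
      aware := fun _ _ => {φ | φ.IsSentence ∧ φ.prims = ∅}
      aware_sentence := fun _ _ _ h => h.1
      aware_lang := fun _ _ _ h => h.2.subset.trans (Set.empty_subset _) }
  have hM : M.IsNrte :=
    { agpp := fun i s φ hφ => by
        refine ⟨fun h p hp => ?_, fun h => ⟨hφ, Set.eq_empty_of_forall_notMem fun p hp => ?_⟩⟩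
        · rw [h.2] at hp
          exact hp.elim
        · exact (Set.singleton_ne_empty p (h p hp).2).elim
      ka := fun _ _ _ _ => rfl
      refl := fun _ _ => trivial
      trans := fun _ _ _ _ _ _ => trivial
      eucl := fun _ _ _ _ _ _ => trivial }
  have hL : (prim r : Formula n Φ V).prims ⊆ M.lang ⟨true⟩ := fun _ _ => .inl rfl
  have := (ExtStructure.sat_Astar hL).1 (h.valid M hM ⟨true⟩ (by simpa using hL)) ⟨false⟩ trivial
  have hr : r ∈ M.lang ⟨false⟩ := this rfl
  simp [M] at hr

namespace IsWorld

variable [Countable Φ] [Infinite Φ] [Countable V] [Infinite V] {L : Set Φ}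
  {Γ : Set (Formula n Φ V)} {φ : Formula n Φ V} {i : Fin n}

/-- A sentence that is not known fails at an accessible world. -/
theorem exists_accessible (h : IsWorld k q L Γ) (hφ : Lng k q φ) (hL : φ.prims ⊆ L)
    (hK : K i φ ∉ Γ) :
    ∃ L' Γ', IsWorld k q L' Γ' ∧ (∀ ψ, K i ψ ∈ Γ ↔ K i ψ ∈ Γ') ∧ φ ∉ Γ' := by
  have hSco : (awarePrims i Γ)ᶜ.Infinite :=
    h.infinite_compl.mono (Set.compl_subset_compl.2 h.awarePrims_subset)
  have hknown : ∀ ψ ∈ known i Γ, Lng k q ψ ∧ ψ.prims ⊆ awarePrims i Γ :=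
    fun ψ hψ => ⟨lng_K.1 (h.lng hψ), h.prims_subset_of_known hψ⟩
  by_cases hS : φ.prims ⊆ awarePrims i Γ
  · have hcon := h.con_insert_neg hφ hS hK
    suffices hs : ∃ L' Γ', IsWorld k q L' Γ' ∧ (∀ ψ, K i ψ ∈ Γ ↔ K i ψ ∈ Γ') ∧ neg φ ∈ Γ' by
      obtain ⟨L', Γ', hW, hrel, hm⟩ := hs
      exact ⟨L', Γ', hW, hrel, (hW.neg_mem hφ (hW.prims_subset hm :)).1 hm⟩
    by_cases hq : q
    · obtain ⟨L', Γ', hW, hrel, hs, -⟩ := h.exists_accessible_of_quant hq (i := i) (F₀ := {neg φ})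
        (by simpa using ⟨hφ, (hS :)⟩) (by simpa using hcon)
      exact ⟨L', Γ', hW, hrel, hs (by simp)⟩
    -- Without quantifiers no counterexamples are needed, so the star-aware propositions alone form
    -- the language.
    · obtain ⟨Γ', hW, hs⟩ := exists_of_con ((hφ.2.2 hq).prims_nonempty.mono hS) hSco
        (B := insert (neg φ) (known i Γ)) (by
          rintro ψ (rfl | hψ)
          · exact ⟨hφ, hS⟩
          · exact hknown ψ hψ) hcon fun hq' => (hq hq').elim
      refine ⟨_, Γ', hW, h.K_mem_iff_of_known_subset hW ((Set.subset_insert _ _).trans hs)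
        fun p hp => hW.prims_subset hp (by simp [prims]), hs (.inl rfl)⟩
  -- Here `φ` fails by being undefined: it is enough that the language of the accessible world omits
  -- `p`.
  · obtain ⟨p, hpφ, hpS⟩ := Set.not_subset.1 hS
    suffices hs : ∃ L' Γ', IsWorld k q L' Γ' ∧ (∀ ψ, K i ψ ∈ Γ ↔ K i ψ ∈ Γ') ∧ p ∉ L' by
      obtain ⟨L', Γ', hW, hrel, hp⟩ := hs
      exact ⟨L', Γ', hW, hrel, fun hm => hp (hW.prims_subset hm hpφ)⟩
    by_cases hq : q
    · obtain ⟨L', Γ', hW, hrel, -, hL'⟩ := h.exists_accessible_of_quant hq (i := i) (F₀ := ∅)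
        (by simp) (by simpa using h.con_known)
      exact ⟨L', Γ', hW, hrel, fun hp => (hL' hp).elim hpS fun hpL => hpL (hL hpφ)⟩
    by_cases hne : (awarePrims i Γ).Nonempty
    · obtain ⟨Γ', hW, hs⟩ := exists_of_con hne hSco hknown h.con_known fun hq' => (hq hq').elim
      exact ⟨_, Γ', hW, h.K_mem_iff_of_known_subset hW hs
        fun p hp => hW.prims_subset hp (by simp [prims]), hpS⟩
    · rw [Set.not_nonempty_iff_eq_empty] at hne
      -- Nothing is known here, so any world without star-awareness is accessible. Languages must be
      -- nonempty, so take `{r}` with `r ≠ p` and impose `¬A_i^* r`.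
      obtain ⟨r, hr⟩ := exists_ne p
      have hcon : Con k q {neg (Astar i (prim r : Formula n Φ V))} := by
        by_contra hc
        rw [← insert_empty_eq] at hc
        obtain ⟨l, hl, hP⟩ := der_of_not_con_neg hc (by simp)
        rw [List.eq_nil_iff_forall_not_mem.2 hl] at hP
        exact not_pr_Astar i r hP
      obtain ⟨Γ', hW, hs⟩ := exists_of_con (Set.singleton_nonempty r)
        (Set.finite_singleton r).infinite_compl
        (B := {neg (Astar i (prim r : Formula n Φ V))}) (by simp [prims]) hcon
        fun hq' => (hq hq').elim
      refine ⟨_, Γ', hW, h.K_mem_iff_of_known_subset hW (fun ψ hψ => ?_) (fun s hm => ?_),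
        fun hp => hr hp.symm⟩
      · have hψ' := hknown ψ hψ
        rw [hne, Set.subset_empty_iff] at hψ'
        exact ((hψ'.1.2.2 hq).prims_nonempty.ne_empty hψ'.2).elim
      · have hsr : s = r := hW.prims_subset hm (by simp [prims])
        subst hsr
        exact ((hW.neg_mem (by simp) (by simp [prims])).1 (hs rfl) hm).elim

end IsWorld

/-! ### Completeness -/

theorem pr_iff_valid [Countable Φ] [Infinite Φ] [Countable V] [Infinite V] {φ : Formula n Φ V}
    (hφ : Lng k q φ) : Pr k q φ ↔ Valid (Rng n Φ V k) φ := by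
  refine ⟨Pr.valid, fun hv => by_contra fun hn => ?_⟩
  obtain ⟨L, Γ, hW, hL, hm⟩ := IsWorld.exists_of_not_pr hφ hn
  refine hm ((sat_canonical (fun s i ψ hψ hψL hK => ?_) φ ⟨L, Γ, hW⟩ hφ).1
    (hv _ isNrte_canonical _ hL))
  obtain ⟨L', Γ', hW', hrel, hm'⟩ := s.isWorld.exists_accessible hψ hψL hK
  exact ⟨⟨L', Γ', hW'⟩, hrel, hm'⟩

/-! ### The three systems as values of the flags -/

theorem Ax_false_true :
    Ax n Φ V False True = schemesAllKXA n Φ V ∩ LAllKXA n Φ V := by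
  ext φ
  simp only [Ax, Lng, schemesAllKXA, schemesAllK, LAllKXA, Set.mem_ofPred_eq, Set.mem_inter_iff,
    Set.mem_union]
  tauto

theorem Ax_true_true : Ax n Φ V True True = schemesAllK n Φ V ∩ LAllK n Φ V := by
  ext φ
  simp only [Ax, Lng, schemesAllK, LAllK, Set.mem_ofPred_eq, Set.mem_inter_iff, Set.mem_union]
  tauto

theorem Ax_true_false : Ax n Φ V True False = schemesK n Φ V ∩ LK n Φ V := by
  ext φ
  simp only [Ax, Lng, LK, Set.mem_ofPred_eq, Set.mem_inter_iff]
  have : φ.QuantFree → φ.IsSentence := fun h => h.free_eq_empty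
  tauto

theorem Rng_false : Rng n Φ V False = LKXA n Φ V := by
  ext φ
  simp [Rng, LKXA]

theorem Rng_true : Rng n Φ V True = LK n Φ V := by
  ext φ
  simp [Rng, LK]

end Awareness

theorem mainTheorem2 {n : ℕ} {Φ V : Type u} [Countable Φ] [Infinite Φ] [Countable V] [Infinite V] :
    (∀ φ ∈ Awareness.LAllKXA n Φ V,
      Awareness.ProvableAllKXA φ ↔ Awareness.Valid (Awareness.LKXA n Φ V) φ) ∧
    (∀ φ ∈ Awareness.LAllK n Φ V,
      Awareness.ProvableAllK φ ↔ Awareness.Valid (Awareness.LK n Φ V) φ) ∧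
    (∀ φ ∈ Awareness.LK n Φ V,
      Awareness.ProvableK φ ↔ Awareness.Valid (Awareness.LK n Φ V) φ) := by
  refine ⟨fun φ hφ => ?_, fun φ hφ => ?_, fun φ hφ => ?_⟩
  · rw [Awareness.ProvableAllKXA, ← Awareness.Ax_false_true, ← Awareness.Rng_false]
    exact Awareness.pr_iff_valid ⟨hφ, False.elim, fun h => (h trivial).elim⟩
  · rw [Awareness.ProvableAllK, ← Awareness.Ax_true_true, ← Awareness.Rng_true]
    exact Awareness.pr_iff_valid ⟨hφ.1, fun _ => hφ.2, fun h => (h trivial).elim⟩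
  · rw [Awareness.ProvableK, ← Awareness.Ax_true_false, ← Awareness.Rng_true]
    exact Awareness.pr_iff_valid ⟨hφ.1.free_eq_empty, fun _ => hφ.2, fun _ => hφ.1⟩
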